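/- Let $F\colon x^3+y^3+z^3=0$ be the Fermat cubic in $\mathbb P^2_{\mathbb C}$. A hyperosculating conic of $F$ is a conic $Q$ for which there is a smooth point $p$ of $F$, not an inflection point, with intersection multiplicity $(F,Q)_p\ge 6$. Let $\omega$ be a primitive cube root of unity and let $$p_1=(1:1:0),\ p_2=(1:\omega:0),\ p_3=(1:\omega^2:0),\ p_4=(0:1:1),\ p_5=(0:1:\omega),\ p_6=(0:1:\omega^2),\ p_7=(1:0:1),\ p_8=(\omega:0:1),\ p_9=(\omega^2:0:1).$$ For $j=1,\dots,9$ let $P_j$ be the set of all hyperosculating conics of $F$ that pass through $p_j$. Then $F$ has exactly $27$ hyperosculating conics, and they are partitioned into the $9$ sets $P_1,\dots,P_9$, each of which contains exactly $3$ conics. Moreover: a) If $Q\neq Q'$ belong to the same set $P_j$, then $Q\cap Q'$ consists of exactly three points: two nodes $A_1$ and one tacnode $A_3$ of the curve $Q\cup Q'$. b) If $Q$ and $Q'$ do not belong to the same set $P_j$, then $Q\cap Q'$ consists of exactly four points, all of them nodes $A_1$ of the curve $Q\cup Q'$. Here a point $p$ of a plane curve is a singularity of type $A_k$ if, in suitable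 analytic local coordinates $(u,v)$ centred at $p$, the curve is given by $u^2+v^{k+1}=0$. -/

import Mathlib

open MvPolynomial
open scoped Topology

namespace PlaneCurve

/-- The complex projective plane. -/
abbrev Plane : Type := Projectivization ℂ (Fin 3 → ℂ)

/-- Ternary polynomials; a plane curve is given by a nonzero homogeneous one. -/
abbrev Poly : Type := MvPolynomial (Fin 3) ℂ

/-- The point `p` lies on the curve `f = 0` (for homogeneous `f`, this does not depend on the
representative of `p`). -/
def PassesThrough (f : Poly) (p : Plane) : Prop := eval p.rep f = 0

/-- A plane conic (smooth or not): a nonzero quadratic form up to a nonzero scalar. -/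
abbrev Conic : Type := Projectivization ℂ (homogeneousSubmodule (Fin 3) ℂ 2)

/-- An equation of the conic `Q`, unique up to a nonzero scalar. -/
noncomputable def Conic.form (Q : Conic) : Poly := (Q.rep : Poly)

/-- The homogeneous prime ideal of the point `p` in `ℂ[x, y, z]`: the polynomials that vanish
identically on the line through the origin represented by `p`. -/
noncomputable def pointIdeal (p : Plane) : Ideal Poly :=
  RingHom.ker (aeval (fun i => Polynomial.C (p.rep i) * Polynomial.X) :
    Poly →ₐ[ℂ] Polynomial ℂ)

instance (p : Plane) : (pointIdeal p).IsPrime := RingHom.ker_isPrime _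

theorem mem_pointIdeal_iff (p : Plane) (f : Poly) :
    f ∈ pointIdeal p ↔ ∀ v ∈ p.submodule, eval v f = 0 := by
  have key : ∀ t : ℂ, Polynomial.eval t (aeval (fun i => Polynomial.C (p.rep i) * Polynomial.X) f)
      = eval (t • p.rep) f := by
    intro t
    have : (Polynomial.evalRingHom t).comp ((aeval (fun i => Polynomial.C (p.rep i) *
        Polynomial.X) : Poly →ₐ[ℂ] Polynomial ℂ) : Poly →+* Polynomial ℂ) = eval (t • p.rep) := by
      apply MvPolynomial.ringHom_ext
      · intro i
        simp
      · intro i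
        simp only [RingHom.comp_apply, RingHom.coe_coe, aeval_X, Polynomial.coe_evalRingHom,
          Polynomial.eval_mul, Polynomial.eval_C, Polynomial.eval_X, eval_X, Pi.smul_apply,
          smul_eq_mul]
        exact mul_comm _ _
    exact congrArg (fun φ : Poly →+* ℂ => φ f) this
  rw [pointIdeal, RingHom.mem_ker, Projectivization.submodule_eq]
  constructor
  · intro h v hv
    obtain ⟨t, rfl⟩ := Submodule.mem_span_singleton.mp hv
    have h' := key t
    rw [← h']
    simpa using congrArg (Polynomial.eval t) h
  · intro h
    apply Polynomial.funext
    intro t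
    simpa using (key t).trans (h _ (Submodule.mem_span_singleton.mpr ⟨t, rfl⟩))

/-- The intersection multiplicity `(f, g)_p` of the curves `f = 0` and `g = 0` at `p`:
the length of `S_P / (f, g)`, where `S = ℂ[x, y, z]` and `P` is the homogeneous prime of `p`.
(This is the definition in Hartshorne's book, and the same number as
the dimension of the local ring of the plane at `p` modulo the local equations of the two curves;
it is `⊤` if the curves have a common component through `p`.) -/
noncomputable def intersectionMultiplicity (f g : Poly) (p : Plane) : ℕ∞ :=
  Module.length (Localization.AtPrime (pointIdeal p))
    (Localization.AtPrime (pointIdeal p) ⧸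
      Ideal.span {algebraMap Poly (Localization.AtPrime (pointIdeal p)) f,
        algebraMap Poly (Localization.AtPrime (pointIdeal p)) g})

/-- `p` is a smooth point of the curve `f = 0`. -/
def IsSmoothPoint (f : Poly) (p : Plane) : Prop :=
  PassesThrough f p ∧ ∃ i, eval p.rep (pderiv i f) ≠ 0

/-- The equation of the projective tangent line of `f = 0` at a smooth point `p`. -/
noncomputable def tangentLine (f : Poly) (p : Plane) : Poly :=
  ∑ i, C (eval p.rep (pderiv i f)) * X i

/-- `p` is an inflection point of `f = 0`. -/
def IsInflectionPoint (f : Poly) (p : Plane) : Prop :=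
  IsSmoothPoint f p ∧ 3 ≤ intersectionMultiplicity f (tangentLine f p) p

/-- `Q` is the osculating conic of `f = 0` at `p`; here `p` is neither a singular point nor an
inflection point. -/
def IsOsculatingConicAt (f : Poly) (Q : Conic) (p : Plane) : Prop :=
  IsSmoothPoint f p ∧ ¬ IsInflectionPoint f p ∧ 5 ≤ intersectionMultiplicity f Q.form p

/-- `Q` is a hyperosculating conic of `f = 0`: at some (sextactic) point `p`, it is the osculating
conic and meets the curve with multiplicity at least `6`. -/
def IsHyperosculatingConic (f : Poly) (Q : Conic) : Prop :=
  ∃ p : Plane, IsOsculatingConicAt f Q p ∧ 6 ≤ intersectionMultiplicity f Q.form p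

/-- The function germ `g` at the origin of `ℂ²` is of type `A_k`: up to an invertible factor `e`,
it is `u² + v ^ (k + 1)` in some analytic local coordinates `u`, `v`. -/
def IsGermOfTypeA (k : ℕ) (g : ℂ × ℂ → ℂ) : Prop :=
  ∃ e u v : ℂ × ℂ → ℂ, AnalyticAt ℂ e 0 ∧ AnalyticAt ℂ u 0 ∧ AnalyticAt ℂ v 0 ∧
    e 0 ≠ 0 ∧ u 0 = 0 ∧ v 0 = 0 ∧
    LinearIndependent ℂ ![fderiv ℂ u 0, fderiv ℂ v 0] ∧
    ∀ᶠ w in 𝓝 0, g w = e w * (u w ^ 2 + v w ^ (k + 1))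

/-- The curve `f = 0` has a singularity of type `A_k` at `p`. The vectors `a`, `b` complete a
representative `r` of `p` to a basis of `ℂ³`; then `(s, t) ↦ [r + s a + t b]` is an affine chart
of the plane centred at `p`. -/
def HasSingularityA (k : ℕ) (f : Poly) (p : Plane) : Prop :=
  ∃ r a b : Fin 3 → ℂ, r ∈ p.submodule ∧ LinearIndependent ℂ ![r, a, b] ∧
    IsGermOfTypeA k (fun w => eval (r + w.1 • a + w.2 • b) f)

/-- `p` is a node (`A₁`) of the union of the conics `Q` and `Q'`. -/
def IsNode (Q Q' : Conic) (p : Plane) : Prop := HasSingularityA 1 (Q.form * Q'.form) p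

/-- `p` is a tacnode (`A₃`) of the union of the conics `Q` and `Q'`. -/
def IsTacnode (Q Q' : Conic) (p : Plane) : Prop := HasSingularityA 3 (Q.form * Q'.form) p

/-- The set of points common to `Q` and `Q'`. -/
def commonPoints (Q Q' : Conic) : Set Plane :=
  {p | PassesThrough Q.form p ∧ PassesThrough Q'.form p}

/-- The Fermat cubic `x³ + y³ + z³`. -/
noncomputable def fermatCubic : Poly := X 0 ^ 3 + X 1 ^ 3 + X 2 ^ 3

/-- The hyperosculating conics of the Fermat cubic. -/
def fermatConics : Set Conic := {Q | IsHyperosculatingConic fermatCubic Q}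

/-- Homogeneous coordinates of nine points of the plane, for a primitive cube root of unity `ω`. -/
noncomputable def ninePointCoords (ω : ℂ) : Fin 9 → Fin 3 → ℂ :=
  ![![1, 1, 0], ![1, ω, 0], ![1, ω ^ 2, 0],
    ![0, 1, 1], ![0, 1, ω], ![0, 1, ω ^ 2],
    ![1, 0, 1], ![ω, 0, 1], ![ω ^ 2, 0, 1]]

theorem ninePointCoords_ne_zero (ω : ℂ) (j : Fin 9) : ninePointCoords ω j ≠ 0 := by
  intro h
  have h0 := congrFun h 0
  have h1 := congrFun h 1
  have h2 := congrFun h 2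
  fin_cases j <;> simp [ninePointCoords] at h0 h1 h2

/-- The nine points `p_j`. -/
noncomputable def ninePoint (ω : ℂ) (j : Fin 9) : Plane :=
  Projectivization.mk ℂ (ninePointCoords ω j) (ninePointCoords_ne_zero ω j)

/-- The set `P_j` of the hyperosculating conics of the Fermat cubic that pass through `p_j`. -/
def conicClass (ω : ℂ) (j : Fin 9) : Set Conic :=
  {Q | Q ∈ fermatConics ∧ PassesThrough Q.form (ninePoint ω j)}

end PlaneCurve

open PlaneCurve

/-! A point of the cubic with a zero coordinate is an inflection point, so a hyperosculating conic
has its contact at a point `r` with all coordinates nonzero. Diagonal rescaling moves `r` to `(1, 1,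
1)` and the cubic to a multiple of `-k x³ + y³ + (k - 1) z³`, `k = -(r₀ / r₁)³`. Expanding a conic
along the branch there up to order six gives six linear equations in its six coefficients, solvable
only if `(k + 1)(k - 2)(2k - 1) = 0`, that is, if two of the three `rᵢ³` agree
(`contact_six_coeffs`). The solution is then unique up to scaling: `(X - Y)² + 2(X + Y)Z - 4Z²` with
`X = xᵢ`, `Y = α xᵢ₊₁`, `Z = β xᵢ₊₂`, `α³ = 1`, `2β³ = -1`. Conversely, this conic is parametrized
by `(1 + s - s² : 1 - s - s² : 1)`, along which the cubic restricts to a multiple of `s⁶`. Hence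
there are 3 · 3 · 3 conics (`mem_fermatConics_iff`).

On `Z = 0` the form becomes `(X - Y)²`, so the conic is tangent to that coordinate line at one of
the nine points, determined by `(i, α)`; it misses the other eight (`passesThrough_ninePoint_iff`).
So `(i, α)` labels the class and `β` its three members. Two members touch at the common point of
tangency, and the difference of their equations factors into `Z = 0` and a line that cuts out two
nodes (`commonPoints_same_class`). For different classes, the second conic pulled back to the
parametrized first one is a quartic with no root at infinity; explicit Bézout identities show that
its roots are simple, which gives four nodes (`commonPoints_of_isTransversal`).

Lengths over the local ring are turned into orders along germs by two bounds:
`le_intersectionMultiplicity` produces multiplicity from contact with a germ, and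
`X_pow_dvd_of_le_intersectionMultiplicity` recovers contact from multiplicity. -/

/-! ### Lengths of cyclic quotients of local rings -/

/-- A lower bound for the length of a quotient ring, from a test homomorphism. -/
theorem le_length_quotient_of_ringHom {A D : Type*} [CommRing A] [CommRing D] (φ : A →+* D)
    (π : D) (n : ℕ) (I : Ideal A) (hI : I ≤ (Ideal.span {π ^ n}).comap φ) (h : A)
    (h1 : ∀ k, π ^ k ∣ φ h ^ k) (h2 : ∀ k, ¬ π ^ (k + 1) ∣ φ h ^ k) :
    (n : ℕ∞) ≤ Module.length A (A ⧸ I) := by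
  -- The pulled-back `π`-adic filtration. The power `h ^ k` separates step `k` from step `k + 1`, so
  -- the first `n + 1` ideals, all containing `I`, give a chain of length `n` in the quotient.
  let N : ℕ → Ideal A := fun k => (Ideal.span {π ^ k}).comap φ
  have memN : ∀ k a, a ∈ N k ↔ π ^ k ∣ φ a := fun k a => by
    simp [N, Ideal.mem_comap, Ideal.mem_span_singleton]
  have hIN : ∀ k ≤ n, I ≤ N k := fun k hk a ha =>
    (memN k a).2 ((pow_dvd_pow π hk).trans ((memN n a).1 (hI ha)))
  have anti : ∀ k, N (k + 1) < N k := fun k => by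
    refine lt_of_le_of_ne (fun a ha => (memN k a).2 ?_) fun hk => ?_
    · exact (pow_dvd_pow π k.le_succ).trans ((memN _ a).1 ha)
    · have : h ^ k ∈ N (k + 1) := hk ▸ (memN k _).2 (by simpa using h1 k)
      exact h2 k (by simpa using (memN _ _).1 this)
  have anti' : StrictAnti N := strictAnti_nat_of_succ_lt anti
  let s : LTSeries (Submodule A (A ⧸ I)) := LTSeries.mk n
    (fun j => Submodule.map I.mkQ (N (n - j))) (by
      intro i j hij
      have hlt : N (n - i) < N (n - j) := anti' (by have := i.2; have := j.2; omega)
      refine lt_of_le_of_ne (Submodule.map_mono hlt.le) fun he => hlt.ne ?_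
      have := congrArg (Submodule.comap I.mkQ) he
      rwa [Submodule.comap_map_mkQ, Submodule.comap_map_mkQ, sup_of_le_right (hIN _ (by omega)),
        sup_of_le_right (hIN _ (by omega))] at this)
  have hs := Order.LTSeries.length_le_krullDim s
  rw [← Module.coe_length] at hs
  exact_mod_cast hs

/-- A cyclic module over a local ring with maximal ideal `(f, h)` whose generator is killed by `f`
and `h ^ k` has length at most `k`. -/
theorem length_le_of_cyclic {A : Type*} [CommRing A] [IsLocalRing A] {f h : A}
    (hm : IsLocalRing.maximalIdeal A ≤ Ideal.span {f, h}) (k : ℕ) :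
    ∀ {M : Type _} [AddCommGroup M] [Module A M] (x : M), Submodule.span A {x} = ⊤ →
      f • x = 0 → h ^ k • x = 0 → Module.length A M ≤ k := by
  induction k with
  | zero =>
    intro M _ _ x hx _ hk
    have hx0 : x = 0 := by simpa using hk
    have : Subsingleton M := by
      rw [hx0, Submodule.span_zero_singleton] at hx
      exact Submodule.subsingleton_iff A |>.1 (subsingleton_of_bot_eq_top hx)
    simp [Module.length_eq_zero]
  | succ k ih =>
    intro M _ _ x hx hf hk
    -- The last layer: `f` and `h` both kill `h ^ k • x`, so `N` is a quotient of the residue field,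
    -- while `M ⧸ N` falls under the induction hypothesis.
    let N : Submodule A M := Submodule.span A {h ^ k • x}
    have e := Module.length_eq_add_of_exact (R := A) N.subtype N.mkQ N.injective_subtype
      N.mkQ_surjective (LinearMap.exact_subtype_mkQ N)
    have hq : Module.length A (M ⧸ N) ≤ k := by
      refine ih (N.mkQ x) ?_ ?_ ?_
      · have := congrArg (Submodule.map N.mkQ) hx
        simpa [Submodule.map_span, Submodule.range_mkQ] using this
      · rw [← map_smul, hf, map_zero]
      · rw [← map_smul]
        rw [Submodule.mkQ_apply, Submodule.Quotient.mk_eq_zero]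
        exact Submodule.mem_span_singleton_self _
    have hN : Module.length A N ≤ 1 := by
      let g : A →ₗ[A] N := LinearMap.toSpanSingleton A N
        ⟨h ^ k • x, Submodule.mem_span_singleton_self _⟩
      have hg : Function.Surjective g := by
        rintro ⟨y, hy⟩
        obtain ⟨a, rfl⟩ := Submodule.mem_span_singleton.1 hy
        exact ⟨a, rfl⟩
      have hker : IsLocalRing.maximalIdeal A ≤ LinearMap.ker g := by
        refine hm.trans (Ideal.span_le.2 ?_)
        rintro a (rfl | rfl)
        · have : a • h ^ k • x = 0 := by rw [smul_comm, hf, smul_zero]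
          exact Subtype.ext this
        · have : a • a ^ k • x = 0 := by rw [smul_smul, ← pow_succ', hk]
          exact Subtype.ext this
      have hl := Module.length_le_of_surjective (R := A)
        ((IsLocalRing.maximalIdeal A).liftQ g hker) (by
          intro y
          obtain ⟨a, rfl⟩ := hg y
          exact ⟨Submodule.Quotient.mk a, rfl⟩)
      have : IsSimpleModule A (A ⧸ IsLocalRing.maximalIdeal A) := by
        rw [isSimpleModule_iff_isCoatom]
        exact (IsLocalRing.maximalIdeal.isMaximal A).out
      rwa [Module.length_eq_one A (A ⧸ IsLocalRing.maximalIdeal A)] at hl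
    rw [e]
    push_cast
    rw [add_comm]
    exact add_le_add hq hN

/-- In a local ring with maximal ideal `(f, h)`, the length modulo `(f, g)` bounds from below the
order of `g` along `f = 0`. -/
theorem mem_span_of_le_length {A : Type*} [CommRing A] [IsLocalRing A] {f h g : A}
    (hm : IsLocalRing.maximalIdeal A ≤ Ideal.span {f, h}) (n : ℕ)
    (hn : (n : ℕ∞) ≤ Module.length A (A ⧸ Ideal.span {f, g})) :
    g ∈ Ideal.span {f, h ^ n} := by
  induction n with
  | zero => simp [Ideal.eq_top_of_isUnit_mem (Ideal.span {f, 1}) (Ideal.subset_span (by simp)) isUnit_one]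
  | succ n ih =>
    obtain ⟨a, b, hab⟩ := Ideal.mem_span_pair.1
      (ih (le_trans (by exact_mod_cast n.le_succ) hn))
    -- If `b` were a unit, `h ^ n` would lie in `(f, g)` and the length would be at most `n`. A
    -- nonunit `b` lies in `(f, h)` and contributes one more factor `h`.
    by_cases hb : IsUnit b
    · exfalso
      obtain ⟨u, rfl⟩ := hb
      have key : h ^ n ∈ Ideal.span {f, g} := Ideal.mem_span_pair.2
        ⟨-(↑u⁻¹ * a), ↑u⁻¹, by rw [← hab]; linear_combination h ^ n * u.inv_mul⟩
      have := length_le_of_cyclic hm n (M := A ⧸ Ideal.span {f, g})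
        (Ideal.Quotient.mk _ 1) (by
          rw [eq_top_iff]
          rintro y -
          obtain ⟨y, rfl⟩ := Ideal.Quotient.mk_surjective y
          refine Submodule.mem_span_singleton.2 ⟨y, ?_⟩
          rw [← Ideal.Quotient.mk_eq_mk, ← Submodule.Quotient.mk_smul]
          simp)
        (by
          rw [← Ideal.Quotient.mk_eq_mk, ← Submodule.Quotient.mk_smul, Ideal.Quotient.mk_eq_mk,
            Ideal.Quotient.eq_zero_iff_mem]
          simpa using Ideal.subset_span (by simp))
        (by
          rw [← Ideal.Quotient.mk_eq_mk, ← Submodule.Quotient.mk_smul, Ideal.Quotient.mk_eq_mk,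
            Ideal.Quotient.eq_zero_iff_mem]
          simpa using key)
      have := hn.trans this
      rw [Nat.cast_le] at this
      omega
    · obtain ⟨c, d, hcd⟩ := Ideal.mem_span_pair.1
        (hm ((IsLocalRing.mem_maximalIdeal b).2 hb))
      exact Ideal.mem_span_pair.2 ⟨a + c * h ^ n, d, by rw [← hab, ← hcd]; ring⟩

namespace PlaneCurve

/-! ### Germs of curves and the local ring at a point -/

/-- The field `ℂ(t)`. -/
abbrev RatField : Type := FractionRing (Polynomial ℂ)

/-- Polynomials over `ℂ` as power series over `ℂ(t)`. -/
noncomputable def toSeries : Polynomial ℂ →+* PowerSeries RatField :=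
  Polynomial.coeToPowerSeries.ringHom.comp (Polynomial.mapRingHom (algebraMap ℂ RatField))

theorem X_pow_dvd_toSeries_iff (n : ℕ) (q : Polynomial ℂ) :
    PowerSeries.X ^ n ∣ toSeries q ↔ Polynomial.X ^ n ∣ q := by
  rw [PowerSeries.X_pow_dvd_iff, Polynomial.X_pow_dvd_iff]
  refine forall₂_congr fun m _ => ?_
  simp [toSeries]

/-- The generic rescaling `t γ` of the polynomial curve germ `γ`, as a substitution. -/
noncomputable def coneEval (γ : Fin 3 → Polynomial ℂ) : Poly →+* PowerSeries RatField :=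
  eval₂Hom (toSeries.comp Polynomial.C)
    (fun i => PowerSeries.C (algebraMap (Polynomial ℂ) RatField Polynomial.X) * toSeries (γ i))

/-- Homogeneity pulls the scale out as `t ^ d`, a unit of `ℂ(t)`; the generic rescaling therefore
leaves orders of vanishing unchanged. -/
theorem coneEval_of_isHomogeneous (γ : Fin 3 → Polynomial ℂ) {f : Poly} {d : ℕ}
    (hf : f.IsHomogeneous d) :
    coneEval γ f = PowerSeries.C (algebraMap (Polynomial ℂ) RatField Polynomial.X) ^ d *
      toSeries (aeval γ f) := by
  rw [coneEval, coe_eval₂Hom, eval₂_eq', aeval_def, eval₂_eq', map_sum, Finset.mul_sum]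
  refine Finset.sum_congr rfl fun m hm => ?_
  have hd : ∑ i, m i = d := by
    have := hf (mem_support_iff.1 hm)
    rw [← this, Finsupp.weight_apply, Finsupp.sum_fintype _ _ (by simp)]
    simp
  simp only [mul_pow, Finset.prod_mul_distrib, Finset.prod_pow_eq_pow_sum, hd, map_mul, map_prod,
    map_pow]
  simp only [RingHom.comp_apply, Polynomial.algebraMap_eq]
  ring

theorem X_pow_dvd_coneEval_iff (γ : Fin 3 → Polynomial ℂ) {f : Poly} {d : ℕ}
    (hf : f.IsHomogeneous d) (n : ℕ) :
    PowerSeries.X ^ n ∣ coneEval γ f ↔ Polynomial.X ^ n ∣ aeval γ f := by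
  rw [coneEval_of_isHomogeneous γ hf, ← X_pow_dvd_toSeries_iff]
  have hu : IsUnit (PowerSeries.C (algebraMap (Polynomial ℂ) RatField Polynomial.X) ^ d) := by
    refine IsUnit.pow _ (IsUnit.map _ ?_)
    simp
  exact hu.dvd_mul_left

/-- This is why the coefficients are taken in `ℂ(t)`: at `X = 0` what remains is the restriction to
the whole line through the origin over `γ(0)`, whose vanishing is membership in `pointIdeal`.
Substituting `γ` alone would not invert every polynomial outside that ideal. -/
theorem constantCoeff_coneEval (γ : Fin 3 → Polynomial ℂ) (f : Poly) :
    PowerSeries.constantCoeff (coneEval γ f) = algebraMap (Polynomial ℂ) RatField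
      (aeval (fun i => Polynomial.C ((γ i).coeff 0) * Polynomial.X) f) := by
  have : (PowerSeries.constantCoeff (R := RatField)).comp (coneEval γ) =
      (algebraMap (Polynomial ℂ) RatField).comp
        (aeval (fun i => Polynomial.C ((γ i).coeff 0) * Polynomial.X) :
          Poly →ₐ[ℂ] Polynomial ℂ).toRingHom := by
    apply MvPolynomial.ringHom_ext
    · intro c
      simp [coneEval, toSeries, IsScalarTower.algebraMap_apply ℂ (Polynomial ℂ) RatField]
    · intro i
      simp only [coneEval, toSeries, RingHom.comp_apply, coe_eval₂Hom, eval₂_X, map_mul,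
        PowerSeries.constantCoeff_C, AlgHom.toRingHom_eq_coe, RingHom.coe_coe, aeval_X]
      rw [mul_comm]
      congr 1
      rw [← PowerSeries.coeff_zero_eq_constantCoeff_apply]
      simp only [Polynomial.coeff_coe, Polynomial.coeff_map,
        Polynomial.coe_mapRingHom, Polynomial.coeToPowerSeries.ringHom_apply]
      exact IsScalarTower.algebraMap_apply ℂ (Polynomial ℂ) RatField _
  exact congrArg (fun φ : Poly →+* RatField => φ f) this

theorem submodule_eq_span (p : Plane) {r : Fin 3 → ℂ} (hr : r ∈ p.submodule) (hr0 : r ≠ 0) :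
    p.submodule = Submodule.span ℂ {r} := by
  rw [Projectivization.submodule_eq] at hr ⊢
  obtain ⟨c, rfl⟩ := Submodule.mem_span_singleton.1 hr
  have hc : c ≠ 0 := by rintro rfl; simp at hr0
  exact (Submodule.span_singleton_smul_eq (IsUnit.mk0 c hc) _).symm

theorem eval_aeval_line (r : Fin 3 → ℂ) (f : Poly) (t : ℂ) :
    Polynomial.eval t (aeval (fun i => Polynomial.C (r i) * Polynomial.X) f) =
      eval (t • r) f := by
  have : (Polynomial.evalRingHom t).comp ((aeval (fun i => Polynomial.C (r i) *
      Polynomial.X) : Poly →ₐ[ℂ] Polynomial ℂ) : Poly →+* Polynomial ℂ) = eval (t • r) := by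
    apply MvPolynomial.ringHom_ext
    · intro i
      simp
    · intro i
      simp only [RingHom.comp_apply, RingHom.coe_coe, aeval_X, Polynomial.coe_evalRingHom,
        Polynomial.eval_mul, Polynomial.eval_C, Polynomial.eval_X, eval_X, Pi.smul_apply,
        smul_eq_mul]
      exact mul_comm _ _
  exact congrArg (fun φ : Poly →+* ℂ => φ f) this

theorem mem_pointIdeal_iff_aeval (p : Plane) {r : Fin 3 → ℂ} (hr : r ∈ p.submodule) (hr0 : r ≠ 0)
    (f : Poly) :
    f ∈ pointIdeal p ↔ aeval (fun i => Polynomial.C (r i) * Polynomial.X) f = 0 := by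
  rw [mem_pointIdeal_iff, submodule_eq_span p hr hr0]
  constructor
  · intro h
    apply Polynomial.funext
    intro t
    rw [eval_aeval_line, h _ (Submodule.mem_span_singleton.2 ⟨t, rfl⟩), Polynomial.eval_zero]
  · intro h v hv
    obtain ⟨t, rfl⟩ := Submodule.mem_span_singleton.1 hv
    rw [← eval_aeval_line, h, Polynomial.eval_zero]

/-- A polynomial curve germ `γ` is centred at the point `p`. -/
def CentredAt (γ : Fin 3 → Polynomial ℂ) (p : Plane) : Prop :=
  (fun i => (γ i).coeff 0) ∈ p.submodule ∧ (fun i => (γ i).coeff 0) ≠ 0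

theorem isUnit_coneEval {γ : Fin 3 → Polynomial ℂ} {p : Plane} (hγ : CentredAt γ p)
    (u : (pointIdeal p).primeCompl) : IsUnit (coneEval γ u) := by
  rw [PowerSeries.isUnit_iff_constantCoeff, constantCoeff_coneEval, isUnit_iff_ne_zero]
  intro h
  exact u.2 ((mem_pointIdeal_iff_aeval p hγ.1 hγ.2 _).2
    ((FaithfulSMul.algebraMap_eq_zero_iff _ _).1 h))

/-- Restriction of elements of the local ring at `p` to the germ `γ`. -/
noncomputable def localEval {γ : Fin 3 → Polynomial ℂ} {p : Plane} (hγ : CentredAt γ p) :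
    Localization.AtPrime (pointIdeal p) →+* PowerSeries RatField :=
  IsLocalization.lift (M := (pointIdeal p).primeCompl) (isUnit_coneEval hγ)

theorem localEval_algebraMap {γ : Fin 3 → Polynomial ℂ} {p : Plane} (hγ : CentredAt γ p)
    (f : Poly) : localEval hγ (algebraMap Poly _ f) = coneEval γ f :=
  IsLocalization.lift_eq _ _

/-- Two curves having contact of order `n` with an immersed germ meet with multiplicity at
least `n`. -/
theorem le_intersectionMultiplicity {γ : Fin 3 → Polynomial ℂ} {p : Plane} (hγ : CentredAt γ p)
    {f g h : Poly} {d d' d'' n : ℕ} (hf : f.IsHomogeneous d) (hg : g.IsHomogeneous d')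
    (hh : h.IsHomogeneous d'') (hfn : Polynomial.X ^ n ∣ aeval γ f)
    (hgn : Polynomial.X ^ n ∣ aeval γ g) (h0 : (aeval γ h).coeff 0 = 0)
    (h1 : (aeval γ h).coeff 1 ≠ 0) :
    (n : ℕ∞) ≤ intersectionMultiplicity f g p := by
  -- The form `h` vanishes to order exactly one along `γ`, so `h ^ k` has order exactly `k` and
  -- serves as the test element for the filtration.
  have hX : PowerSeries.X ∣ coneEval γ h := by
    have := (X_pow_dvd_coneEval_iff γ hh 1).2 (by simpa [Polynomial.X_dvd_iff] using h0)
    simpa using this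
  have hX2 : ¬ PowerSeries.X ^ 2 ∣ coneEval γ h := by
    rw [X_pow_dvd_coneEval_iff γ hh, Polynomial.X_pow_dvd_iff]
    exact fun H => h1 (H 1 (by norm_num))
  obtain ⟨u, hu⟩ := hX
  have hu' : ¬ PowerSeries.X ∣ u := by
    rintro ⟨w, rfl⟩
    exact hX2 ⟨w, by rw [hu]; ring⟩
  refine le_length_quotient_of_ringHom (localEval hγ) PowerSeries.X n _ ?_
    (algebraMap Poly _ h) (fun k => ?_) (fun k => ?_)
  · rw [Ideal.span_le]
    rintro a (rfl | rfl)
    · simpa [Ideal.mem_span_singleton, localEval_algebraMap] using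
        (X_pow_dvd_coneEval_iff γ hf n).2 hfn
    · simpa [Ideal.mem_span_singleton, localEval_algebraMap] using
        (X_pow_dvd_coneEval_iff γ hg n).2 hgn
  · rw [localEval_algebraMap, hu, mul_pow]
    exact dvd_mul_right _ _
  · rw [localEval_algebraMap, hu, mul_pow, pow_succ]
    intro H
    have := (mul_dvd_mul_iff_left (pow_ne_zero k PowerSeries.X_ne_zero)).1 H
    exact hu' (PowerSeries.X_prime.dvd_of_dvd_pow this)

/-- The order along a germ of `f = 0` is at least the intersection multiplicity with `f = 0`. -/
theorem X_pow_dvd_of_le_intersectionMultiplicity {γ : Fin 3 → Polynomial ℂ} {p : Plane}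
    (hγ : CentredAt γ p) {f g h : Poly} {d d' d'' n : ℕ} (hf : f.IsHomogeneous d)
    (hg : g.IsHomogeneous d') (hh : h.IsHomogeneous d'')
    (hm : IsLocalRing.maximalIdeal (Localization.AtPrime (pointIdeal p)) ≤
      Ideal.span {algebraMap Poly _ f, algebraMap Poly _ h})
    (hfn : Polynomial.X ^ n ∣ aeval γ f) (h0 : (aeval γ h).coeff 0 = 0)
    (hn : (n : ℕ∞) ≤ intersectionMultiplicity f g p) :
    Polynomial.X ^ n ∣ aeval γ g := by
  have hX : PowerSeries.X ∣ coneEval γ h := by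
    have := (X_pow_dvd_coneEval_iff γ hh 1).2 (by simpa [Polynomial.X_dvd_iff] using h0)
    simpa using this
  obtain ⟨a, b, hab⟩ := Ideal.mem_span_pair.1 (mem_span_of_le_length hm n hn)
  have := congrArg (localEval hγ) hab
  simp only [map_add, map_mul, map_pow, localEval_algebraMap] at this
  rw [← X_pow_dvd_coneEval_iff γ hg, ← this]
  exact dvd_add (((X_pow_dvd_coneEval_iff γ hf n).2 hfn).mul_left _)
    ((pow_dvd_pow_of_dvd hX n).mul_left _)

/-! ### Generators of the maximal ideal at a point of the cubic -/

/-- The homogeneous ideal of a point off the line `z = 0` is generated by two linear forms. -/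
theorem pointIdeal_le_span (p : Plane) {r : Fin 3 → ℂ} (hr : r ∈ p.submodule) (h2 : r 2 ≠ 0) :
    pointIdeal p ≤ Ideal.span {C (r 2) * X 0 - C (r 0) * X 2, C (r 2) * X 1 - C (r 1) * X 2} := by
  set J : Ideal Poly :=
    Ideal.span {C (r 2) * X 0 - C (r 0) * X 2, C (r 2) * X 1 - C (r 1) * X 2} with hJ
  have hr0 : r ≠ 0 := fun h => h2 (by rw [h]; rfl)
  -- Modulo `J` every coordinate is `rᵢ` times `z / r₂`. Hence restriction to the line, followed by
  -- `T ↦ z / r₂`, is the quotient map, and the kernel of the restriction lies in `J`.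
  let ψ : Polynomial ℂ →ₐ[ℂ] Poly ⧸ J :=
    Polynomial.aeval (Ideal.Quotient.mk J (C (r 2)⁻¹ * X 2))
  have hψ : ψ.comp (aeval (fun i => Polynomial.C (r i) * Polynomial.X) : Poly →ₐ[ℂ] _) =
      Ideal.Quotient.mkₐ ℂ J := by
    apply MvPolynomial.algHom_ext
    intro i
    have hc : ∀ c : ℂ, algebraMap ℂ (Poly ⧸ J) c = Ideal.Quotient.mk J (C c) := fun c => rfl
    have hinv : (C (r 2)⁻¹ * C (r 2) : Poly) = 1 := by
      rw [← C_mul, inv_mul_cancel₀ h2, C_1]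
    simp only [AlgHom.comp_apply, aeval_X, map_mul, ψ, Polynomial.aeval_C, Polynomial.aeval_X, hc,
      Ideal.Quotient.mkₐ_eq_mk]
    rw [← map_mul, ← map_mul, Ideal.Quotient.eq]
    fin_cases i
    · have : (C (r 0) * (C (r 2)⁻¹ * X 2) - X 0 : Poly) =
          -C (r 2)⁻¹ * (C (r 2) * X 0 - C (r 0) * X 2) := by linear_combination X 0 * hinv
      simp only [Fin.zero_eta, Fin.isValue]
      rw [this]
      exact Ideal.mul_mem_left _ _ (Ideal.subset_span (by simp))
    · have : (C (r 1) * (C (r 2)⁻¹ * X 2) - X 1 : Poly) =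
          -C (r 2)⁻¹ * (C (r 2) * X 1 - C (r 1) * X 2) := by linear_combination X 1 * hinv
      simp only [Fin.mk_one, Fin.isValue]
      rw [this]
      exact Ideal.mul_mem_left _ _ (Ideal.subset_span (by simp))
    · have : (C (r 2) * (C (r 2)⁻¹ * X 2) - X 2 : Poly) = 0 := by linear_combination X 2 * hinv
      simp only [Fin.reduceFinMk, Fin.isValue]
      rw [this]
      exact J.zero_mem
  intro f hf
  rw [mem_pointIdeal_iff_aeval p hr hr0] at hf
  have := congrArg (fun φ : Poly →ₐ[ℂ] Poly ⧸ J => φ f) hψ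
  simp only [AlgHom.comp_apply, hf, map_zero, Ideal.Quotient.mkₐ_eq_mk] at this
  exact Ideal.Quotient.eq_zero_iff_mem.1 this.symm

theorem isHomogeneous_fermatCubic : fermatCubic.IsHomogeneous 3 :=
  (((isHomogeneous_X_pow _ _).add (isHomogeneous_X_pow _ _)).add (isHomogeneous_X_pow _ _))

/-- With `l` and `m` the two linear generators, expanding `(l + r₀ z)³` and `(m + r₁ z)³` gives `r₂³
F = U l + V m`. At `p` the value of `V` is `3 r₁² r₂² ≠ 0`, so `V` is a local unit and `m` can be
replaced by `F`. -/
theorem maximalIdeal_le_span_fermatCubic (p : Plane) {r : Fin 3 → ℂ} (hr : r ∈ p.submodule)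
    (h1 : r 1 ≠ 0) (h2 : r 2 ≠ 0) (hF : r 0 ^ 3 + r 1 ^ 3 + r 2 ^ 3 = 0) :
    IsLocalRing.maximalIdeal (Localization.AtPrime (pointIdeal p)) ≤
      Ideal.span {algebraMap Poly _ fermatCubic,
        algebraMap Poly _ (C (r 2) * X 0 - C (r 0) * X 2)} := by
  set A := Localization.AtPrime (pointIdeal p)
  set l : Poly := C (r 2) * X 0 - C (r 0) * X 2 with hl
  set m : Poly := C (r 2) * X 1 - C (r 1) * X 2 with hm
  set V : Poly := m ^ 2 + 3 * m * C (r 1) * X 2 + 3 * C (r 1) ^ 2 * X 2 ^ 2 with hV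
  set U : Poly := l ^ 2 + 3 * l * C (r 0) * X 2 + 3 * C (r 0) ^ 2 * X 2 ^ 2 with hU
  have hFC : (C (r 0) ^ 3 + C (r 1) ^ 3 + C (r 2) ^ 3 : Poly) = 0 := by
    rw [← C_pow, ← C_pow, ← C_pow, ← C_add, ← C_add, hF, C_0]
  have key : V * m = C (r 2) ^ 3 * fermatCubic - U * l := by
    rw [hV, hU, hl, hm, fermatCubic]
    linear_combination (-X 2 ^ 3) * hFC
  have hVu : IsUnit (algebraMap Poly A V) := by
    refine IsLocalization.map_units A (⟨V, fun hmem => ?_⟩ : (pointIdeal p).primeCompl)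
    have := (mem_pointIdeal_iff p V).1 hmem r hr
    simp [hV, hm, h1, h2, mul_comm] at this
  rw [← Localization.AtPrime.map_eq_maximalIdeal]
  refine (Ideal.map_mono (pointIdeal_le_span p hr h2)).trans ?_
  rw [Ideal.map_span, Ideal.span_le]
  rintro a ⟨b, rfl | rfl, rfl⟩
  · exact Ideal.subset_span (Set.mem_insert_of_mem _ rfl)
  · obtain ⟨u, hu⟩ := hVu
    refine Ideal.mem_span_pair.2 ⟨↑u⁻¹ * algebraMap Poly A (C (r 2) ^ 3),
      -(↑u⁻¹ * algebraMap Poly A U), ?_⟩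
    have k := congrArg (algebraMap Poly A) key
    simp only [map_mul, map_sub] at k
    rw [← hu] at k
    linear_combination (-(↑u⁻¹ : A)) * k + algebraMap Poly A m * u.inv_mul
-- Conics with sixfold contact
/-- The quadratic form with the given coefficients of `x²`, `y²`, `z²`, `xy`, `xz`, `yz`. -/
noncomputable def quadric (a b c d e f : ℂ) : Poly :=
  C a * X 0 ^ 2 + C b * X 1 ^ 2 + C c * X 2 ^ 2 + C d * (X 0 * X 1) + C e * (X 0 * X 2) +
    C f * (X 1 * X 2)

theorem exists_eq_quadric {q : Poly} (hq : q.IsHomogeneous 2) :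
    ∃ a b c d e f, q = quadric a b c d e f := by
  rw [q.as_sum]
  refine Finset.sum_induction _ (fun q => ∃ a b c d e f, q = quadric a b c d e f) ?_ ?_ ?_
  · rintro _ _ ⟨a, b, c, d, e, f, rfl⟩ ⟨a', b', c', d', e', f', rfl⟩
    refine ⟨a + a', b + b', c + c', d + d', e + e', f + f', ?_⟩
    simp only [quadric, C_add]
    ring
  · exact ⟨0, 0, 0, 0, 0, 0, by simp [quadric]⟩
  · intro m hm
    have hd : m 0 + m 1 + m 2 = 2 := by
      have := hq (mem_support_iff.1 hm)
      refine Eq.trans ?_ this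
      rw [Finsupp.weight_apply, Finsupp.sum_fintype _ _ (by simp)]
      simp [Fin.sum_univ_three]
    rw [monomial_eq, Finsupp.prod_fintype _ _ (by simp), Fin.prod_univ_three]
    generalize coeff m q = t
    generalize m 0 = i, m 1 = j, m 2 = k at hd
    have hi : i ≤ 2 := by omega
    have hj : j ≤ 2 := by omega
    obtain rfl : k = 2 - i - j := by omega
    interval_cases i <;> interval_cases j <;> first | omega | skip
    · exact ⟨0, 0, t, 0, 0, 0, by simp [quadric]⟩
    · exact ⟨0, 0, 0, 0, 0, t, by simp [quadric]⟩
    · exact ⟨0, t, 0, 0, 0, 0, by simp [quadric]⟩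
    · exact ⟨0, 0, 0, 0, t, 0, by simp [quadric]⟩
    · exact ⟨0, 0, 0, t, 0, 0, by simp [quadric]⟩
    · exact ⟨t, 0, 0, 0, 0, 0, by simp [quadric]⟩

/-- A branch at `(1, 1)` of `k x³ - y³ = k - 1`, as `x = 1 + 3 s`, `y = 1 + η(s)` up to
order `6`. -/
noncomputable def cubicBranch (k : ℂ) : Polynomial ℂ :=
  Polynomial.C (3 * k) * Polynomial.X + Polynomial.C (9 * (k * (1 - k))) * Polynomial.X ^ 2 +
    Polynomial.C (9 * (k * (1 - k)) * (1 - 5 * k)) * Polynomial.X ^ 3 +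
    Polynomial.C (135 * (k * (1 - k)) * (k * (2 * k - 1))) * Polynomial.X ^ 4 +
    Polynomial.C (162 * (k * (1 - k)) * (k * (-1 + 9 * k - 11 * k ^ 2))) * Polynomial.X ^ 5

theorem X_pow_dvd_cubicBranch (k : ℂ) :
    (Polynomial.X : Polynomial ℂ) ^ 6 ∣ (1 + cubicBranch k) ^ 3 -
      Polynomial.C k * (1 + 3 * Polynomial.X) ^ 3 + Polynomial.C (k - 1) := by
  set x : Polynomial ℂ := Polynomial.X with hx
  set κ : Polynomial ℂ := Polynomial.C k with hκ
  -- The equation reads `y³ = 1 + 9z`, and `T` is the binomial series of `(1 + 9z)^(1/3)` cut after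
  -- degree 5; `cubicBranch` is `T - 1` cut again in `x`. The factor 3 in `1 + 3x` keeps the
  -- coefficients integral.
  obtain ⟨z, hz⟩ : ∃ z : Polynomial ℂ, z = κ * (x + 3 * x ^ 2 + 3 * x ^ 3) := ⟨_, rfl⟩
  obtain ⟨T, hT⟩ : ∃ T : Polynomial ℂ,
    T = 1 + 3 * z - 9 * z ^ 2 + 45 * z ^ 3 - 270 * z ^ 4 + 1782 * z ^ 5 := ⟨_, rfl⟩
  have h1 : x ^ 6 ∣ T - (1 + cubicBranch k) := by
    rw [hT, hz]
    refine ⟨-81 * κ ^ 2 + 3645 * κ ^ 3 + 4860 * κ ^ 3 * x ^ 1 + 3645 * κ ^ 3 * x ^ 2 + 1215 * κ ^ 3 * x ^ 3 + -17820 * κ ^ 4 + -58320 * κ ^ 4 * x ^ 1 + -123930 * κ ^ 4 * x ^ 2 + -174960 * κ ^ 4 * x ^ 3 + -160380 * κ ^ 4 * x ^ 4 + -87480 * κ ^ 4 * x ^ 5 + -21870 * κ ^ 4 * x ^ 6 + 26730 * κ ^ 5 + 187110 * κ ^ 5 * x ^ 1 + 801900 * κ ^ 5 * x ^ 2 + 2325510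 * κ ^ 5 * x ^ 3 + 4763286 * κ ^ 5 * x ^ 4 + 6976530 * κ ^ 5 * x ^ 5 + 7217100 * κ ^ 5 * x ^ 6 + 5051970 * κ ^ 5 * x ^ 7 + 2165130 * κ ^ 5 * x ^ 8 + 433026 * κ ^ 5 * x ^ 9, ?_⟩
    simp only [cubicBranch, ← hx, Polynomial.C_mul, Polynomial.C_sub, Polynomial.C_add,
      Polynomial.C_neg, Polynomial.C_pow, ← hκ, Polynomial.C_ofNat, Polynomial.C_1]
    ring
  have h2 : x ^ 6 ∣ T ^ 3 - (1 + 9 * z) := by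
    have : z ^ 6 ∣ T ^ 3 - (1 + 9 * z) :=
      ⟨37422 - 48114 * z + 72171 * z ^ 2 + 392931 * z ^ 3 - 7072758 * z ^ 4 + 75228426 * z ^ 5 -
        235329948 * z ^ 6 + 818419140 * z ^ 7 - 2572174440 * z ^ 8 + 5658783768 * z ^ 9, by
        rw [hT]; ring⟩
    exact (pow_dvd_pow_of_dvd ⟨κ * (1 + 3 * x + 3 * x ^ 2), by rw [hz]; ring⟩ 6).trans this
  have h3 : x ^ 6 ∣ T ^ 3 - (1 + cubicBranch k) ^ 3 := h1.trans (sub_dvd_pow_sub_pow _ _ _)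
  have : (1 + cubicBranch k) ^ 3 - κ * (1 + 3 * x) ^ 3 + Polynomial.C (k - 1) =
      (T ^ 3 - (1 + 9 * z)) - (T ^ 3 - (1 + cubicBranch k) ^ 3) := by
    rw [Polynomial.C_sub, ← hκ, Polynomial.C_1, hz]
    ring
  rw [this]
  exact dvd_sub h2 h3

theorem coeffs_eq_zero_of_X_pow_dvd {e0 e1 e2 e3 e4 e5 : ℂ} {R : Polynomial ℂ}
    (h : (Polynomial.X : Polynomial ℂ) ^ 6 ∣ Polynomial.C e0 + Polynomial.C e1 * Polynomial.X +
      Polynomial.C e2 * Polynomial.X ^ 2 + Polynomial.C e3 * Polynomial.X ^ 3 +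
      Polynomial.C e4 * Polynomial.X ^ 4 + Polynomial.C e5 * Polynomial.X ^ 5 +
      Polynomial.X ^ 6 * R) :
    e0 = 0 ∧ e1 = 0 ∧ e2 = 0 ∧ e3 = 0 ∧ e4 = 0 ∧ e5 = 0 := by
  have h' := (dvd_add_left (dvd_mul_right (Polynomial.X ^ 6) R)).1 h
  rw [Polynomial.X_pow_dvd_iff] at h'
  have h0 := h' 0 (by norm_num)
  have h1 := h' 1 (by norm_num)
  have h2 := h' 2 (by norm_num)
  have h3 := h' 3 (by norm_num)
  have h4 := h' 4 (by norm_num)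
  have h5 := h' 5 (by norm_num)
  simp [Polynomial.coeff_X_pow, Polynomial.coeff_X, Polynomial.coeff_C] at h0 h1 h2 h3 h4 h5
  exact ⟨h0, h1, h2, h3, h4, h5⟩

/-- The conics having contact of order `6` at `(1, 1, 1)` with the diagonal cubic
`-k x³ + y³ + (k - 1) z³ = 0`. -/
theorem contact_six_coeffs {k a b c d e f : ℂ} (hk0 : k ≠ 0) (hk1 : k ≠ 1)
    (hne : ¬ (a = 0 ∧ b = 0 ∧ c = 0 ∧ d = 0 ∧ e = 0 ∧ f = 0))
    (h : (Polynomial.X : Polynomial ℂ) ^ 6 ∣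
      aeval ![1 + 3 * Polynomial.X, 1 + cubicBranch k, 1] (quadric a b c d e f)) :
    ∃ t : ℂ, t ≠ 0 ∧
      ((k = -1 ∧ a = t ∧ b = t ∧ c = -4 * t ∧ d = -2 * t ∧ e = 2 * t ∧ f = 2 * t) ∨
       (k = 2 ∧ a = -4 * t ∧ b = t ∧ c = t ∧ d = 2 * t ∧ e = 2 * t ∧ f = -2 * t) ∨
       (2 * k = 1 ∧ a = t ∧ b = -4 * t ∧ c = t ∧ d = 2 * t ∧ e = -2 * t ∧ f = 2 * t)) := by
  obtain ⟨u, hu⟩ : ∃ u, u = k * (1 - k) := ⟨_, rfl⟩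
  have hu0 : u ≠ 0 := by
    rw [hu]; exact mul_ne_zero hk0 (sub_ne_zero.2 (Ne.symm hk1))
  have key : ∃ R : Polynomial ℂ,
      aeval ![1 + 3 * Polynomial.X, 1 + cubicBranch k, 1] (quadric a b c d e f) =
      Polynomial.C (a + b + c + d + e + f) +
      Polynomial.C (3 * (2 * a + d + e) + (2 * b + d + f) * (3 * k)) * Polynomial.X +
      Polynomial.C (9 * a + (2 * b + d + f) * (9 * u) + 9 * d * k + 9 * b * k ^ 2) *
        Polynomial.X ^ 2 +
      Polynomial.C (9 * u * ((2 * b + d + f) * (1 - 5 * k) + (3 * d + 6 * b * k))) *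
        Polynomial.X ^ 3 +
      Polynomial.C (9 * u * ((2 * b + d + f) * (15 * k * (2 * k - 1)) +
        (3 * d + 6 * b * k) * (1 - 5 * k) + 9 * u * b)) * Polynomial.X ^ 4 +
      Polynomial.C (27 * u * ((2 * b + d + f) * (6 * k * (-1 + 9 * k - 11 * k ^ 2)) +
        (3 * d + 6 * b * k) * (5 * k * (2 * k - 1)) + 6 * u * b * (1 - 5 * k))) *
        Polynomial.X ^ 5 + Polynomial.X ^ 6 * R := by
    obtain ⟨η3, h3⟩ : ∃ t, t = 9 * u * (1 - 5 * k) := ⟨_, rfl⟩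
    obtain ⟨η4, h4⟩ : ∃ t, t = 135 * u * (k * (2 * k - 1)) := ⟨_, rfl⟩
    obtain ⟨η5, h5⟩ : ∃ t, t = 162 * u * (k * (-1 + 9 * k - 11 * k ^ 2)) := ⟨_, rfl⟩
    refine ⟨Polynomial.C b * (Polynomial.C (6 * k * η5 + 18 * u * η4 + η3 ^ 2) +
      Polynomial.C (18 * u * η5 + 2 * η3 * η4) * Polynomial.X +
      Polynomial.C (2 * η3 * η5 + η4 ^ 2) * Polynomial.X ^ 2 +
      Polynomial.C (2 * η4 * η5) * Polynomial.X ^ 3 + Polynomial.C (η5 ^ 2) * Polynomial.X ^ 4) +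
      3 * Polynomial.C (d * η5), ?_⟩
    have e3 : 9 * u * ((2 * b + d + f) * (1 - 5 * k) + (3 * d + 6 * b * k)) =
      (2 * b + d + f) * η3 + 27 * d * u + 54 * b * k * u := by rw [h3]; ring
    have e4 : 9 * u * ((2 * b + d + f) * (15 * k * (2 * k - 1)) +
        (3 * d + 6 * b * k) * (1 - 5 * k) + 9 * u * b) =
      (2 * b + d + f) * η4 + 3 * d * η3 + b * (6 * k * η3 + 81 * u ^ 2) := by rw [h3, h4]; ring
    have e5 : 27 * u * ((2 * b + d + f) * (6 * k * (-1 + 9 * k - 11 * k ^ 2)) +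
        (3 * d + 6 * b * k) * (5 * k * (2 * k - 1)) + 6 * u * b * (1 - 5 * k)) =
      (2 * b + d + f) * η5 + 3 * d * η4 + b * (6 * k * η4 + 18 * u * η3) := by
      rw [h3, h4, h5]; ring
    rw [e3, e4, e5]
    simp only [quadric, map_add, map_mul, map_pow, aeval_X, algHom_C, Polynomial.algebraMap_eq,
      Matrix.cons_val_zero, Matrix.cons_val_one, Matrix.cons_val, cubicBranch, ← hu, ← h3, ← h4,
      ← h5, Polynomial.C_ofNat]
    ring
  obtain ⟨R, hR⟩ := key
  rw [hR] at h
  obtain ⟨e0, e1, e2, e3, e4, e5⟩ := coeffs_eq_zero_of_X_pow_dvd h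
  replace e3 := (mul_eq_zero.1 e3).resolve_left (mul_ne_zero (by norm_num) hu0)
  replace e4 := (mul_eq_zero.1 e4).resolve_left (mul_ne_zero (by norm_num) hu0)
  replace e5 := (mul_eq_zero.1 e5).resolve_left (mul_ne_zero (by norm_num) hu0)
  -- `w` is `∂q/∂y` at `(1, 1, 1)` and `D` its derivative along the tangent vector `(3, 3k, 0)`. The
  -- three top equations are linear in `w`, `D` and `u * b`; their determinant is a constant
  -- multiple of `(k + 1)(k - 2)(2k - 1)`. If `w = 0`, the whole conic vanishes.
  obtain ⟨w, hw⟩ : ∃ w, w = 2 * b + d + f := ⟨_, rfl⟩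
  obtain ⟨D, hD⟩ : ∃ D, D = 3 * d + 6 * b * k := ⟨_, rfl⟩
  rw [← hw, ← hD] at e3 e4 e5
  rw [← hw] at e1 e2
  have hD' : D = -w * (1 - 5 * k) := by linear_combination e3
  have hdet : w * ((k + 1) * (k - 2) * (2 * k - 1)) = 0 := by
    rw [hD'] at e4 e5
    linear_combination 3 * (e5 - (1 - 5 * k) * 2 / 3 * e4)
  have hw0 : w ≠ 0 := by
    intro h0
    rw [h0] at hD' e4 hw e1 e2
    rw [hD'] at e4 hD
    have hb : b = 0 := by
      have : u * b = 0 := by linear_combination e4 / 9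
      exact (mul_eq_zero.1 this).resolve_left hu0
    subst hb
    have hd : d = 0 := by linear_combination -hD / 3
    subst hd
    have hf : f = 0 := by linear_combination -hw
    subst hf
    have ha : a = 0 := by linear_combination e2 / 9
    subst ha
    have he : e = 0 := by linear_combination e1 / 3
    subst he
    exact hne ⟨rfl, rfl, by linear_combination e0, rfl, rfl, rfl⟩
  rcases mul_eq_zero.1 ((mul_eq_zero.1 hdet).resolve_left hw0) with hk | hk
  · rcases mul_eq_zero.1 hk with hk | hk
    · obtain rfl : k = -1 := by linear_combination hk
      obtain rfl : u = -2 := by rw [hu]; norm_num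
      refine ⟨w / 2, div_ne_zero hw0 two_ne_zero, Or.inl ?_⟩
      have hb : b = w / 2 := by grind
      have hd : d = -w := by grind
      have hf : f = w := by grind
      have ha : a = w / 2 := by grind
      have he : e = w := by grind
      grind
    · obtain rfl : k = 2 := by linear_combination hk
      obtain rfl : u = -2 := by rw [hu]; norm_num
      refine ⟨w / 2, div_ne_zero hw0 two_ne_zero, Or.inr (Or.inl ?_)⟩
      have hb : b = w / 2 := by grind
      have hd : d = w := by grind
      have hf : f = -w := by grind
      have ha : a = -2 * w := by grind
      have he : e = w := by grind
      grind
  · obtain rfl : k = 1 / 2 := by linear_combination hk / 2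
    obtain rfl : u = 1 / 4 := by rw [hu]; norm_num
    refine ⟨-w / 4, div_ne_zero (neg_ne_zero.2 hw0) (by norm_num), Or.inr (Or.inr ?_)⟩
    have hb : b = w := by grind
    have hd : d = -w / 2 := by grind
    have hf : f = -w / 2 := by grind
    have ha : a = -w / 4 := by grind
    have he : e = w / 2 := by grind
    grind

/-! ### The contact conics -/

/-- The quadratic form `(X - Y)² + 2 (X + Y) Z - 4 Z²`, where `X`, `Y`, `Z` are the coordinates
with indices `i`, `i + 1`, `i + 2`, the last two multiplied by `α` and `β`. -/
noncomputable def contactForm (i : Fin 3) (α β : ℂ) : Poly :=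
  (X i - C α * X (i + 1)) ^ 2 + C 2 * ((X i + C α * X (i + 1)) * (C β * X (i + 2))) -
    C 4 * (C β * X (i + 2)) ^ 2

theorem isHomogeneous_contactForm (i : Fin 3) (α β : ℂ) : (contactForm i α β).IsHomogeneous 2 := by
  refine IsHomogeneous.sub (IsHomogeneous.add ?_ ?_) ?_
  · exact ((isHomogeneous_X _ _).sub (isHomogeneous_C_mul_X _ _)).pow 2
  · exact (((isHomogeneous_X _ _).add (isHomogeneous_C_mul_X _ _)).mul
      (isHomogeneous_C_mul_X _ _)).C_mul 2
  · exact ((isHomogeneous_C_mul_X _ _).pow 2).C_mul 4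

theorem eval_contactForm (i : Fin 3) (α β : ℂ) (v : Fin 3 → ℂ) :
    eval v (contactForm i α β) = (v i - α * v (i + 1)) ^ 2 +
      2 * ((v i + α * v (i + 1)) * (β * v (i + 2))) - 4 * (β * v (i + 2)) ^ 2 := by
  simp [contactForm]

theorem contactForm_ne_zero (i : Fin 3) (α β : ℂ) : contactForm i α β ≠ 0 := by
  intro h
  have := congrArg (eval (Pi.single i 1)) h
  rw [eval_contactForm] at this
  fin_cases i <;> simp at this

/-- The conic defined by `contactForm`. -/
noncomputable def contactConic (i : Fin 3) (α β : ℂ) : Conic :=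
  Projectivization.mk ℂ ⟨contactForm i α β, isHomogeneous_contactForm i α β⟩
    (fun h => contactForm_ne_zero i α β (congrArg Subtype.val h))

theorem contactConic_form (i : Fin 3) (α β : ℂ) :
    ∃ c : ℂ, c ≠ 0 ∧ (contactConic i α β).form = C c * contactForm i α β := by
  obtain ⟨c, hc⟩ := Projectivization.exists_smul_eq_mk_rep ℂ
    (⟨contactForm i α β, isHomogeneous_contactForm i α β⟩ : homogeneousSubmodule (Fin 3) ℂ 2)
    (fun h => contactForm_ne_zero i α β (congrArg Subtype.val h))
  refine ⟨c, c.ne_zero, ?_⟩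
  rw [Conic.form, contactConic, ← hc]
  simp [Units.smul_def, smul_eq_C_mul]

theorem Conic.form_ne_zero (Q : Conic) : Q.form ≠ 0 := fun h => Q.rep_nonzero (Subtype.ext h)

theorem Conic.form_isHomogeneous (Q : Conic) : Q.form.IsHomogeneous 2 := Q.rep.2

theorem eq_contactConic_of_form {Q : Conic} {i : Fin 3} {α β t : ℂ}
    (h : Q.form = C t * contactForm i α β) : Q = contactConic i α β := by
  rw [← Q.mk_rep, contactConic, Projectivization.mk_eq_mk_iff']
  refine ⟨t, Subtype.ext ?_⟩
  rw [← smul_eq_C_mul] at h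
  exact h.symm

theorem contactForm_zero_eq (α β : ℂ) : contactForm 0 α β =
    quadric 1 (α ^ 2) (-4 * β ^ 2) (-2 * α) (2 * β) (2 * α * β) := by
  simp only [contactForm, quadric, map_mul, map_pow, map_neg, map_one, zero_add, Fin.isValue]
  simp only [map_ofNat]
  ring

theorem contactForm_one_eq (α β : ℂ) : contactForm 1 α β =
    quadric (-4 * β ^ 2) 1 (α ^ 2) (2 * β) (2 * α * β) (-2 * α) := by
  simp only [contactForm, quadric, map_mul, map_pow, map_neg, map_one, Fin.isValue, Fin.reduceAdd]
  simp only [map_ofNat]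
  ring

theorem contactForm_two_eq (α β : ℂ) : contactForm 2 α β =
    quadric (α ^ 2) (-4 * β ^ 2) 1 (2 * α * β) (-2 * α) (2 * β) := by
  simp only [contactForm, quadric, map_mul, map_pow, map_neg, map_one, Fin.isValue, Fin.reduceAdd]
  simp only [map_ofNat]
  ring

theorem C_mul_quadric (t a b c d e f : ℂ) :
    C t * quadric a b c d e f = quadric (t * a) (t * b) (t * c) (t * d) (t * e) (t * f) := by
  simp only [quadric, map_mul]
  ring

/-! ### Inflection points and hyperosculating conics of the Fermat cubic -/

theorem eval_fermatCubic (v : Fin 3 → ℂ) :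
    eval v fermatCubic = v 0 ^ 3 + v 1 ^ 3 + v 2 ^ 3 := by
  simp [fermatCubic]

theorem eval_pderiv_fermatCubic (i : Fin 3) (v : Fin 3 → ℂ) :
    eval v (pderiv i fermatCubic) = 3 * v i ^ 2 := by
  fin_cases i <;> simp [fermatCubic, pderiv_X]

theorem rep_ne_zero (p : Plane) : ∃ i, p.rep i ≠ 0 := by
  by_contra! h
  exact p.rep_nonzero (funext h)

theorem rep_mem_submodule (p : Plane) : p.rep ∈ p.submodule := by
  rw [Projectivization.submodule_eq]
  exact Submodule.mem_span_singleton_self _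

theorem isSmoothPoint_fermatCubic {p : Plane} (h : PassesThrough fermatCubic p) :
    IsSmoothPoint fermatCubic p := by
  obtain ⟨i, hi⟩ := rep_ne_zero p
  exact ⟨h, i, by rw [eval_pderiv_fermatCubic]; simp [hi]⟩

theorem tangentLine_fermatCubic (p : Plane) : tangentLine fermatCubic p =
    C (3 * p.rep 0 ^ 2) * X 0 + C (3 * p.rep 1 ^ 2) * X 1 + C (3 * p.rep 2 ^ 2) * X 2 := by
  simp only [tangentLine, Fin.sum_univ_three, eval_pderiv_fermatCubic]

theorem isHomogeneous_tangentLine (p : Plane) :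
    (tangentLine fermatCubic p).IsHomogeneous 1 := by
  rw [tangentLine_fermatCubic]
  exact ((isHomogeneous_C_mul_X _ _).add (isHomogeneous_C_mul_X _ _)).add
    (isHomogeneous_C_mul_X _ _)

/-- When `pᵢ = 0`, the tangent line does not involve `xᵢ`, so moving only that coordinate stays on
it; the cubic restricts to `X ^ 3` there. -/
theorem isInflectionPoint_fermatCubic_of_zero {p : Plane} (h : PassesThrough fermatCubic p)
    {i : Fin 3} (hi : p.rep i = 0) : IsInflectionPoint fermatCubic p := by
  refine ⟨isSmoothPoint_fermatCubic h, ?_⟩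
  obtain ⟨γ, hγ⟩ : ∃ γ : Fin 3 → Polynomial ℂ, γ = fun j =>
    Polynomial.C (p.rep j) + if j = i then Polynomial.X else 0 := ⟨_, rfl⟩
  have h0 : ∀ j, (γ j).coeff 0 = p.rep j := fun j => by
    rw [hγ]; by_cases hj : j = i <;> simp [hj]
  have hc : CentredAt γ p := by
    have : (fun j => (γ j).coeff 0) = p.rep := funext h0
    exact ⟨this ▸ rep_mem_submodule p, this ▸ p.rep_nonzero⟩
  rw [PassesThrough, eval_fermatCubic] at h
  have hC : (Polynomial.C (p.rep 0) ^ 3 + Polynomial.C (p.rep 1) ^ 3 +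
      Polynomial.C (p.rep 2) ^ 3 : Polynomial ℂ) = 0 := by
    simp only [← Polynomial.C_pow, ← Polynomial.C_add, h, Polynomial.C_0]
  refine le_intersectionMultiplicity (n := 3) (h := X i) hc isHomogeneous_fermatCubic
    (isHomogeneous_tangentLine p) (isHomogeneous_X _ _) ?_ ?_ ?_ ?_
  · refine ⟨1, ?_⟩
    simp only [fermatCubic, map_add, map_pow, aeval_X, hγ]
    fin_cases i <;> simp at hi <;> simp [hi] at hC ⊢ <;> linear_combination hC
  · have : aeval γ (tangentLine fermatCubic p) = 0 := by
      rw [tangentLine_fermatCubic]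
      simp only [map_add, map_mul, aeval_X, algHom_C, Polynomial.algebraMap_eq, hγ]
      fin_cases i <;> simp at hi <;> simp [hi, Polynomial.C_ofNat] at hC ⊢ <;>
        linear_combination 3 * hC
    rw [this]
    exact dvd_zero _
  · rw [aeval_X, h0, hi]
  · simp [hγ]

/-- The germ of the Fermat cubic at a point `(r₀ : r₁ : r₂)` that is not an inflection point. -/
noncomputable def fermatBranch (r : Fin 3 → ℂ) : Fin 3 → Polynomial ℂ :=
  ![Polynomial.C (r 0) * (1 + 3 * Polynomial.X),
    Polynomial.C (r 1) * (1 + cubicBranch (-(r 0 ^ 3 / r 1 ^ 3))), Polynomial.C (r 2)]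

theorem fermatBranch_coeff_zero (r : Fin 3 → ℂ) :
    (fun j => (fermatBranch r j).coeff 0) = r := by
  funext j
  fin_cases j <;> simp [fermatBranch, cubicBranch]

theorem X_pow_dvd_fermatBranch {r : Fin 3 → ℂ} (hF : r 0 ^ 3 + r 1 ^ 3 + r 2 ^ 3 = 0)
    (h1 : r 1 ≠ 0) : (Polynomial.X : Polynomial ℂ) ^ 6 ∣ aeval (fermatBranch r) fermatCubic := by
  have e0 : r 0 ^ 3 = r 1 ^ 3 * -(-(r 0 ^ 3 / r 1 ^ 3)) := by field_simp
  have e2 : r 2 ^ 3 = r 1 ^ 3 * (-(r 0 ^ 3 / r 1 ^ 3) - 1) := by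
    field_simp
    linear_combination hF
  have : aeval (fermatBranch r) fermatCubic = Polynomial.C (r 1 ^ 3) *
      ((1 + cubicBranch (-(r 0 ^ 3 / r 1 ^ 3))) ^ 3 -
      Polynomial.C (-(r 0 ^ 3 / r 1 ^ 3)) * (1 + 3 * Polynomial.X) ^ 3 +
      Polynomial.C (-(r 0 ^ 3 / r 1 ^ 3) - 1)) := by
    have E0 := congrArg (Polynomial.C (R := ℂ)) e0
    have E2 := congrArg (Polynomial.C (R := ℂ)) e2
    rw [map_mul, map_neg] at E0
    rw [map_mul] at E2
    simp only [fermatCubic, map_add, map_pow, aeval_X, fermatBranch, Matrix.cons_val_zero,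
      Matrix.cons_val_one, Matrix.cons_val]
    simp only [map_pow] at E0 E2 ⊢
    linear_combination (1 + 3 * Polynomial.X) ^ 3 * E0 + E2
  rw [this]
  exact (X_pow_dvd_cubicBranch _).mul_left _

/-- The restriction `n ≤ 6` is the precision to which `fermatBranch` is known to follow the cubic.
-/
theorem X_pow_dvd_fermatBranch_of_le {p : Plane} (h : PassesThrough fermatCubic p)
    (h1 : p.rep 1 ≠ 0) (h2 : p.rep 2 ≠ 0) {g : Poly} {d n : ℕ} (hg : g.IsHomogeneous d)
    (hn6 : n ≤ 6) (hn : (n : ℕ∞) ≤ intersectionMultiplicity fermatCubic g p) :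
    Polynomial.X ^ n ∣ aeval (fermatBranch p.rep) g := by
  have hF := h
  rw [PassesThrough, eval_fermatCubic] at hF
  refine X_pow_dvd_of_le_intersectionMultiplicity (γ := fermatBranch p.rep)
    ⟨?_, ?_⟩ isHomogeneous_fermatCubic hg
    (((isHomogeneous_C_mul_X _ _).sub (isHomogeneous_C_mul_X _ _)))
    (maximalIdeal_le_span_fermatCubic p (rep_mem_submodule p) h1 h2 hF)
    ((pow_dvd_pow _ hn6).trans (X_pow_dvd_fermatBranch hF h1)) ?_ hn
  · rw [fermatBranch_coeff_zero]
    exact rep_mem_submodule p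
  · rw [fermatBranch_coeff_zero]
    exact p.rep_nonzero
  · simp [fermatBranch, mul_comm]

theorem fermatParameter_ne {r : Fin 3 → ℂ} (hF : r 0 ^ 3 + r 1 ^ 3 + r 2 ^ 3 = 0)
    (h0 : r 0 ≠ 0) (h1 : r 1 ≠ 0) (h2 : r 2 ≠ 0) :
    -(r 0 ^ 3 / r 1 ^ 3) ≠ 0 ∧ -(r 0 ^ 3 / r 1 ^ 3) ≠ 1 := by
  refine ⟨neg_ne_zero.2 (div_ne_zero (pow_ne_zero _ h0) (pow_ne_zero _ h1)), fun h => ?_⟩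
  field_simp at h
  exact pow_ne_zero 3 h2 (by linear_combination hF + h)

/-- Along the branch the tangent line has `X ^ 2` coefficient `27 r₁³ k (1 - k)`, which is nonzero
because `k ≠ 0, 1`. -/
theorem not_isInflectionPoint_fermatCubic {p : Plane} (h : PassesThrough fermatCubic p)
    (h0 : p.rep 0 ≠ 0) (h1 : p.rep 1 ≠ 0) (h2 : p.rep 2 ≠ 0) :
    ¬ IsInflectionPoint fermatCubic p := by
  rintro ⟨-, hn⟩
  have hd := X_pow_dvd_fermatBranch_of_le h h1 h2 (isHomogeneous_tangentLine p)
    (by norm_num : 3 ≤ 6) hn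
  have hF := h
  rw [PassesThrough, eval_fermatCubic] at hF
  obtain ⟨k0, k1⟩ := fermatParameter_ne hF h0 h1 h2
  have hc := Polynomial.X_pow_dvd_iff.1 hd 2 (by norm_num)
  have hT : aeval (fermatBranch p.rep) (tangentLine fermatCubic p) =
      Polynomial.C (3 * p.rep 0 ^ 3) * (1 + 3 * Polynomial.X) + Polynomial.C (3 * p.rep 1 ^ 3) *
        (1 + cubicBranch (-(p.rep 0 ^ 3 / p.rep 1 ^ 3))) + Polynomial.C (3 * p.rep 2 ^ 3) := by
    rw [tangentLine_fermatCubic]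
    simp only [map_add, map_mul, map_pow, aeval_X, algHom_C, Polynomial.algebraMap_eq,
      fermatBranch, Matrix.cons_val_zero, Matrix.cons_val_one, Matrix.cons_val]
    ring
  rw [hT] at hc
  generalize -(p.rep 0 ^ 3 / p.rep 1 ^ 3) = k at hc k0 k1
  have k1' : 1 - k ≠ 0 := sub_ne_zero.2 (Ne.symm k1)
  have h3 : (1 + 3 * Polynomial.X : Polynomial ℂ).coeff 2 = 0 := by
    rw [← Polynomial.C_ofNat]
    simp [Polynomial.coeff_one]
  have hb : (1 + cubicBranch k).coeff 2 = 9 * (k * (1 - k)) := by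
    simp only [cubicBranch, Polynomial.coeff_add, Polynomial.coeff_C_mul, Polynomial.coeff_X_pow,
      Polynomial.coeff_X, Polynomial.coeff_one]
    simp
  rw [Polynomial.coeff_add, Polynomial.coeff_add, Polynomial.coeff_C_mul, Polynomial.coeff_C_mul,
    h3, hb, Polynomial.coeff_C] at hc
  simp [h1, k0, k1'] at hc

theorem isHyperosculatingConic_contactConic {i : Fin 3} {α β : ℂ} (hα : α ^ 3 = 1)
    (hβ : 2 * β ^ 3 = -1) : IsHyperosculatingConic fermatCubic (contactConic i α β) := by
  have hα0 : α ≠ 0 := by rintro rfl; norm_num at hα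
  have hβ0 : β ≠ 0 := by rintro rfl; norm_num at hβ
  -- The contact point is `X = Y = Z = 1` in the scaled coordinates; it lies on the cubic because
  -- the cubes of the actual coordinates are proportional to `1, 1, -2`.
  obtain ⟨p, t, ht, hp, hp1, hp2⟩ : ∃ p : Plane, ∃ t : ℂ, t ≠ 0 ∧ p.rep i = t ∧
      p.rep (i + 1) = t * α⁻¹ ∧ p.rep (i + 2) = t * β⁻¹ := by
    let r : Fin 3 → ℂ := fun j => if j = i then 1 else if j = i + 1 then α⁻¹ else β⁻¹
    have hr : r ≠ 0 := fun h => by simpa [r] using congrFun h i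
    obtain ⟨c, hc⟩ := Projectivization.exists_smul_eq_mk_rep ℂ r hr
    refine ⟨Projectivization.mk ℂ r hr, c, c.ne_zero, ?_, ?_, ?_⟩ <;>
      rw [← hc] <;> fin_cases i <;> simp [r, Units.smul_def]
  have ha3 : (α⁻¹) ^ 3 = 1 := by rw [inv_pow, hα, inv_one]
  have hb3 : (β⁻¹) ^ 3 = -2 := by
    field_simp
    linear_combination hβ
  have hall : ∀ j, p.rep j ≠ 0 := by
    have a1 : p.rep (i + 1) ≠ 0 := by rw [hp1]; exact mul_ne_zero ht (inv_ne_zero hα0)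
    have a2 : p.rep (i + 2) ≠ 0 := by rw [hp2]; exact mul_ne_zero ht (inv_ne_zero hβ0)
    have a0 : p.rep i ≠ 0 := hp ▸ ht
    intro j
    fin_cases i <;> fin_cases j <;> assumption
  have hFe : ∀ i : Fin 3, fermatCubic = X i ^ 3 + X (i + 1) ^ 3 + X (i + 2) ^ 3 := by
    intro i
    fin_cases i <;> simp [fermatCubic] <;> ring
  have hpF : PassesThrough fermatCubic p := by
    rw [PassesThrough, hFe i]
    simp only [map_add, map_pow, eval_X, hp, hp1, hp2, mul_pow, ha3, hb3]
    ring
  -- The test germ parametrizes the conic, not the cubic: the conic vanishes on it identically, and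
  -- `(1 + s - s²)³ + (1 - s - s²)³ - 2 = -2 s⁶`.
  obtain ⟨γ, hγ⟩ : ∃ γ : Fin 3 → Polynomial ℂ, γ = fun j =>
    Polynomial.C (p.rep j) * if j = i then 1 + Polynomial.X - Polynomial.X ^ 2 else
      if j = i + 1 then 1 - Polynomial.X - Polynomial.X ^ 2 else 1 := ⟨_, rfl⟩
  have g0 : γ i = Polynomial.C t * (1 + Polynomial.X - Polynomial.X ^ 2) := by
    rw [hγ]; simp [hp]
  have g1 : Polynomial.C α * γ (i + 1) =
      Polynomial.C t * (1 - Polynomial.X - Polynomial.X ^ 2) := by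
    rw [hγ]; simp only [hp1]
    rw [if_neg (by fin_cases i <;> decide), if_pos trivial, ← mul_assoc, ← Polynomial.C_mul]
    congr 2
    field_simp
  have g2 : Polynomial.C β * γ (i + 2) = Polynomial.C t := by
    rw [hγ]; simp only [hp2]
    rw [if_neg (by fin_cases i <;> decide), if_neg (by fin_cases i <;> decide), mul_one,
      ← Polynomial.C_mul]
    congr 1
    field_simp
  have hγ0 : (fun j => (γ j).coeff 0) = p.rep := by
    funext j
    rw [hγ]
    by_cases h1 : j = i
    · simp [h1]
    · by_cases h2 : j = i + 1
      · simp [h2]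
      · simp [h1, h2]
  have h6 : ((6 : ℕ) : ℕ∞) ≤
      intersectionMultiplicity fermatCubic (contactConic i α β).form p := by
    refine le_intersectionMultiplicity (γ := γ) (h := X i - C α * X (i + 1))
      ⟨by rw [hγ0]; exact rep_mem_submodule p, by rw [hγ0]; exact p.rep_nonzero⟩
      isHomogeneous_fermatCubic (Conic.form_isHomogeneous _)
      ((isHomogeneous_X _ _).sub (isHomogeneous_C_mul_X _ _)) ?_ ?_ ?_ ?_
    · refine ⟨Polynomial.C t ^ 3 * -2, ?_⟩
      have A3 : Polynomial.C α ^ 3 = 1 := by rw [← Polynomial.C_pow, hα, Polynomial.C_1]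
      have B3 : 2 * Polynomial.C β ^ 3 = -1 := by
        have := congrArg (Polynomial.C (R := ℂ)) hβ
        simpa [Polynomial.C_ofNat] using this
      have G1 := congrArg (· ^ 3) g1
      have G2 := congrArg (· ^ 3) g2
      simp only [mul_pow, A3, one_mul] at G1 G2
      rw [hFe i]
      simp only [map_add, map_pow, aeval_X]
      rw [g0]
      linear_combination G1 - 2 * G2 + γ (i + 2) ^ 3 * B3
    · have : aeval γ (contactForm i α β) = 0 := by
        simp only [contactForm, map_add, map_sub, map_mul, map_pow, aeval_X, algHom_C,
          Polynomial.algebraMap_eq, g0, g1, g2]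
        simp only [Polynomial.C_ofNat]
        ring
      obtain ⟨c, -, hc⟩ := contactConic_form i α β
      rw [hc, map_mul, this, mul_zero]
      exact dvd_zero _
    · simp only [map_sub, map_mul, aeval_X, algHom_C, Polynomial.algebraMap_eq, g0, g1]
      simp
    · simp only [map_sub, map_mul, aeval_X, algHom_C, Polynomial.algebraMap_eq, g0, g1]
      simp [Polynomial.coeff_one, Polynomial.coeff_X_pow, ht, ← two_mul]
  refine ⟨p, ⟨isSmoothPoint_fermatCubic hpF,
    not_isInflectionPoint_fermatCubic hpF (hall 0) (hall 1) (hall 2), ?_⟩, h6⟩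
  exact le_trans (by norm_num) h6

theorem exists_eq_contactConic {Q : Conic} (hQ : IsHyperosculatingConic fermatCubic Q) :
    ∃ i α β, α ^ 3 = 1 ∧ 2 * β ^ 3 = -1 ∧ Q = contactConic i α β := by
  obtain ⟨p, ⟨⟨hp, -⟩, hni, -⟩, h6⟩ := hQ
  have hall : ∀ i, p.rep i ≠ 0 := fun i hi => hni (isInflectionPoint_fermatCubic_of_zero hp hi)
  have hF := hp
  rw [PassesThrough, eval_fermatCubic] at hF
  have h0 := hall 0
  have h1 := hall 1
  have h2 := hall 2
  have hd := X_pow_dvd_fermatBranch_of_le hp h1 h2 Q.form_isHomogeneous le_rfl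
    (by exact_mod_cast h6)
  obtain ⟨a, b, c, d, e, f, hq⟩ := exists_eq_quadric Q.form_isHomogeneous
  generalize p.rep = r at *
  obtain ⟨k0, k1⟩ := fermatParameter_ne hF h0 h1 h2
  have hne : ¬ (a * r 0 ^ 2 = 0 ∧ b * r 1 ^ 2 = 0 ∧ c * r 2 ^ 2 = 0 ∧ d * (r 0 * r 1) = 0 ∧
      e * (r 0 * r 2) = 0 ∧ f * (r 1 * r 2) = 0) := by
    simp only [mul_eq_zero, pow_eq_zero_iff two_ne_zero, h0, h1, h2, or_false]
    rintro ⟨rfl, rfl, rfl, rfl, rfl, rfl⟩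
    exact Q.form_ne_zero (by rw [hq]; simp [quadric])
  obtain ⟨t, ht, hcase⟩ := contact_six_coeffs k0 k1 hne (by
    rw [hq] at hd
    convert hd using 1
    simp only [quadric, map_add, map_mul, map_pow, aeval_X, algHom_C, Polynomial.algebraMap_eq,
      fermatBranch, Matrix.cons_val_zero, Matrix.cons_val_one, Matrix.cons_val]
    ring)
  -- The three values of `k` correspond to `r₀³ = r₁³`, `r₁³ = r₂³` and `r₂³ = r₀³`. The equal pair
  -- occupies positions `i, i + 1`, and `α`, `β` are the ratios of `rᵢ` to the next two coordinates.
  rcases hcase with ⟨hk, ha, hb, hc, hd, he, hf⟩ | ⟨hk, ha, hb, hc, hd, he, hf⟩ |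
    ⟨hk, ha, hb, hc, hd, he, hf⟩
  · have hk' : r 0 ^ 3 = r 1 ^ 3 := by field_simp at hk; linear_combination -hk
    refine ⟨0, r 0 / r 1, r 0 / r 2, ?_, ?_, eq_contactConic_of_form (t := t / r 0 ^ 2) ?_⟩
    · rw [div_pow, hk', div_self (pow_ne_zero _ h1)]
    · field_simp
      linear_combination hF + hk'
    · rw [hq, contactForm_zero_eq, C_mul_quadric]
      congr 1 <;> field_simp
      · exact ha
      · exact hb
      · linear_combination hc
      · linear_combination hd
      · linear_combination he
      · linear_combination hf
  · have hk' : r 0 ^ 3 = -2 * r 1 ^ 3 := by field_simp at hk; linear_combination -hk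
    refine ⟨1, r 1 / r 2, r 1 / r 0, ?_, ?_, eq_contactConic_of_form (t := t / r 1 ^ 2) ?_⟩
    · field_simp
      linear_combination -hF + hk'
    · field_simp
      linear_combination hk'
    · rw [hq, contactForm_one_eq, C_mul_quadric]
      congr 1 <;> field_simp
      · linear_combination ha
      · exact hb
      · exact hc
      · linear_combination hd
      · linear_combination he
      · linear_combination hf
  · have hk' : r 1 ^ 3 = -2 * r 0 ^ 3 := by field_simp at hk; linear_combination -hk
    refine ⟨2, r 2 / r 0, r 2 / r 1, ?_, ?_, eq_contactConic_of_form (t := t / r 2 ^ 2) ?_⟩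
    · field_simp
      linear_combination hF - hk'
    · field_simp
      linear_combination 2 * hF - hk'
    · rw [hq, contactForm_two_eq, C_mul_quadric]
      congr 1 <;> field_simp
      · exact ha
      · linear_combination hb
      · exact hc
      · linear_combination hd
      · linear_combination he
      · linear_combination hf

theorem mem_fermatConics_iff (Q : Conic) : Q ∈ fermatConics ↔
    ∃ i α β, α ^ 3 = 1 ∧ 2 * β ^ 3 = -1 ∧ Q = contactConic i α β := by
  refine ⟨exists_eq_contactConic, ?_⟩
  rintro ⟨i, α, β, hα, hβ, rfl⟩
  exact isHyperosculatingConic_contactConic hα hβ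

/-! ### Evaluation at points given by coordinates -/

theorem eval_smul_of_isHomogeneous {f : Poly} {d : ℕ} (hf : f.IsHomogeneous d) (t : ℂ)
    (v : Fin 3 → ℂ) : eval (t • v) f = t ^ d * eval v f := by
  rw [eval_eq', eval_eq', Finset.mul_sum]
  refine Finset.sum_congr rfl fun m hm => ?_
  have hd : ∑ i, m i = d := by
    have := hf (mem_support_iff.1 hm)
    refine Eq.trans ?_ this
    rw [Finsupp.weight_apply, Finsupp.sum_fintype _ _ (by simp)]
    simp
  simp only [Pi.smul_apply, smul_eq_mul, mul_pow, Finset.prod_mul_distrib,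
    Finset.prod_pow_eq_pow_sum, hd]
  ring

theorem passesThrough_mk_iff {f : Poly} {d : ℕ} (hf : f.IsHomogeneous d) {v : Fin 3 → ℂ}
    (hv : v ≠ 0) : PassesThrough f (Projectivization.mk ℂ v hv) ↔ eval v f = 0 := by
  obtain ⟨c, hc⟩ := Projectivization.exists_smul_eq_mk_rep ℂ v hv
  rw [PassesThrough, ← hc, Units.smul_def, eval_smul_of_isHomogeneous hf]
  simp

theorem mem_commonPoints_mk_iff (Q Q' : Conic) {v : Fin 3 → ℂ} (hv : v ≠ 0) :
    Projectivization.mk ℂ v hv ∈ commonPoints Q Q' ↔ eval v Q.form = 0 ∧ eval v Q'.form = 0 := by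
  rw [commonPoints, Set.mem_ofPred_eq, passesThrough_mk_iff Q.form_isHomogeneous,
    passesThrough_mk_iff Q'.form_isHomogeneous]

theorem mem_submodule_mk {v : Fin 3 → ℂ} (hv : v ≠ 0) :
    v ∈ (Projectivization.mk ℂ v hv).submodule := by
  rw [Projectivization.submodule_mk]
  exact Submodule.mem_span_singleton_self _

theorem commonPoints_comm (Q Q' : Conic) : commonPoints Q Q' = commonPoints Q' Q :=
  Set.ext fun _ => and_comm

theorem IsNode.symm {Q Q' : Conic} {p : Plane} (h : IsNode Q Q' p) : IsNode Q' Q p := by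
  rwa [IsNode, mul_comm]

/-! ### Local normal forms of nodes and tacnodes -/

theorem hasFDerivAt_linear_add_quadratic (l m x y z : ℂ) :
    HasFDerivAt (fun w : ℂ × ℂ => l * w.1 + m * w.2 + (x * w.1 ^ 2 + y * (w.1 * w.2) + z * w.2 ^ 2))
      (l • ContinuousLinearMap.fst ℂ ℂ ℂ + m • ContinuousLinearMap.snd ℂ ℂ ℂ) 0 := by
  have h1 : HasFDerivAt (fun w : ℂ × ℂ => w.1) (ContinuousLinearMap.fst ℂ ℂ ℂ) 0 := hasFDerivAt_fst
  have h2 : HasFDerivAt (fun w : ℂ × ℂ => w.2) (ContinuousLinearMap.snd ℂ ℂ ℂ) 0 := hasFDerivAt_snd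
  have := ((h1.const_mul l).add (h2.const_mul m)).add
    ((((h1.pow 2).const_mul x).add ((h1.mul h2).const_mul y)).add ((h2.pow 2).const_mul z))
  refine this.congr_fderiv ?_
  ext <;> simp

theorem linearIndependent_pair_clm {L M : ℂ × ℂ →L[ℂ] ℂ}
    (h : L (1, 0) * M (0, 1) - L (0, 1) * M (1, 0) ≠ 0) : LinearIndependent ℂ ![L, M] := by
  rw [LinearIndependent.pair_iff]
  intro s t hst
  have e1 := congrArg (fun T : ℂ × ℂ →L[ℂ] ℂ => T (1, 0)) hst
  have e2 := congrArg (fun T : ℂ × ℂ →L[ℂ] ℂ => T (0, 1)) hst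
  simp only [add_apply, smul_apply, smul_eq_mul,
    zero_apply] at e1 e2
  constructor
  · refine (mul_eq_zero.1 ?_).resolve_right h
    linear_combination M (0, 1) * e1 - M (1, 0) * e2
  · refine (mul_eq_zero.1 ?_).resolve_right h
    linear_combination L (1, 0) * e2 - L (0, 1) * e1

attribute [local fun_prop] analyticAt_fst analyticAt_snd

/-- Two smooth transversal branches form a node. -/
theorem isGermOfTypeA_one_of_transversal {l m x y z l' m' x' y' z' c : ℂ} (hc : c ≠ 0)
    (hdet : l * m' - m * l' ≠ 0) {g : ℂ × ℂ → ℂ}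
    (hg : ∀ w, g w = c *
      ((l * w.1 + m * w.2 + (x * w.1 ^ 2 + y * (w.1 * w.2) + z * w.2 ^ 2)) *
        (l' * w.1 + m' * w.2 + (x' * w.1 ^ 2 + y' * (w.1 * w.2) + z' * w.2 ^ 2)))) :
    IsGermOfTypeA 1 g := by
  have h1 := hasFDerivAt_linear_add_quadratic ((l + l') / 2) ((m + m') / 2) ((x + x') / 2)
    ((y + y') / 2) ((z + z') / 2)
  have h2 := hasFDerivAt_linear_add_quadratic (Complex.I * (l - l') / 2)
    (Complex.I * (m - m') / 2) (Complex.I * (x - x') / 2) (Complex.I * (y - y') / 2)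
    (Complex.I * (z - z') / 2)
  -- For branches `F`, `G` the coordinates are `u = (F + G) / 2` and `v = i (F - G) / 2`, so that
  -- `u² + v² = F G`.
  refine ⟨fun _ => c, fun w => (l + l') / 2 * w.1 + (m + m') / 2 * w.2 + ((x + x') / 2 * w.1 ^ 2 +
      (y + y') / 2 * (w.1 * w.2) + (z + z') / 2 * w.2 ^ 2),
    fun w => Complex.I * (l - l') / 2 * w.1 + Complex.I * (m - m') / 2 * w.2 +
      (Complex.I * (x - x') / 2 * w.1 ^ 2 +
      Complex.I * (y - y') / 2 * (w.1 * w.2) + Complex.I * (z - z') / 2 * w.2 ^ 2),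
    analyticAt_const, ?_, ?_, hc, ?_, ?_, ?_, Filter.Eventually.of_forall fun w => ?_⟩
  · fun_prop
  · fun_prop
  · simp
  · simp
  · rw [h1.fderiv, h2.fderiv]
    apply linearIndependent_pair_clm
    simp only [add_apply, smul_apply, smul_eq_mul,
      ContinuousLinearMap.coe_fst', ContinuousLinearMap.coe_snd']
    intro h
    exact hdet ((mul_eq_zero.1 (by linear_combination 2 * h :
      Complex.I * (l * m' - m * l') * -1 = 0)).elim
        (fun h => (mul_eq_zero.1 h).resolve_left Complex.I_ne_zero) (fun h => by norm_num at h))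
  · rw [hg]
    linear_combination (-c / 4 * (((l - l') * w.1 + (m - m') * w.2 + ((x - x') * w.1 ^ 2 +
      (y - y') * (w.1 * w.2) + (z - z') * w.2 ^ 2)) ^ 2)) * Complex.I_sq

/-- Two smooth branches `s² + 4 b t (1 - b t)` and `s² + 4 b' t (1 - b' t)` form a tacnode. -/
theorem isGermOfTypeA_three {b b' c : ℂ} (hb : b ≠ 0) (hb' : b' ≠ 0) (hbb : b ≠ b') (hc : c ≠ 0)
    {g : ℂ × ℂ → ℂ}
    (hg : ∀ w, g w = c * ((w.1 ^ 2 + 4 * (b * w.2) - 4 * (b * w.2) ^ 2) *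
      (w.1 ^ 2 + 4 * (b' * w.2) - 4 * (b' * w.2) ^ 2))) :
    IsGermOfTypeA 3 g := by
  have hsub : b - b' ≠ 0 := sub_ne_zero.2 hbb
  have hAc : ContinuousAt (fun w : ℂ × ℂ => 4 * b * (1 - b * w.2)) 0 := by fun_prop
  have hBc : ContinuousAt (fun w : ℂ × ℂ => 4 * b' * (1 - b' * w.2)) 0 := by fun_prop
  have hDc : ContinuousAt (fun w : ℂ × ℂ => 4 * b * (1 - b * w.2) - 4 * b' * (1 - b' * w.2)) 0 := by
    fun_prop
  have hA0 := hAc.eventually_ne (y := 0) (by simpa using hb)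
  have hB0 := hBc.eventually_ne (y := 0) (by simpa using hb')
  have hD0 := hDc.eventually_ne (y := 0) (by
    have : 4 * b - 4 * b' ≠ 0 := by rw [← mul_sub]; exact mul_ne_zero (by norm_num) hsub
    simpa using this)
  have h1 : HasFDerivAt (fun w : ℂ × ℂ => w.1) (ContinuousLinearMap.fst ℂ ℂ ℂ) 0 := hasFDerivAt_fst
  have h2 : HasFDerivAt (fun w : ℂ × ℂ => w.2) (ContinuousLinearMap.snd ℂ ℂ ℂ) 0 := hasFDerivAt_snd
  have hF : AnalyticAt ℂ (fun w : ℂ × ℂ => Complex.I * (2 * (4 * b * (1 - b * w.2)) *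
      (4 * b' * (1 - b' * w.2))) / (4 * b * (1 - b * w.2) - 4 * b' * (1 - b' * w.2))) 0 := by
    refine AnalyticAt.div (by fun_prop) (by fun_prop) hD0.self_of_nhds
  have hG : AnalyticAt ℂ (fun w : ℂ × ℂ => Complex.I * (4 * b * (1 - b * w.2) +
      4 * b' * (1 - b' * w.2)) / (4 * b * (1 - b * w.2) - 4 * b' * (1 - b' * w.2))) 0 := by
    refine AnalyticAt.div (by fun_prop) (by fun_prop) hD0.self_of_nhds
  -- Write the branches as `s² + A t`, `s² + B t` with `A = 4b(1 - bt)`, `B = 4b'(1 - b't)`.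
  -- Completing the square in `t` turns the product into `((2ABt + (A + B)s²)² - (A - B)² s⁴) /
  -- (4AB)`; dividing by `-(A - B)² / (4AB)` leaves `u² + s⁴`. Here `b ≠ b'` makes `A - B` a unit.
  refine ⟨fun w => -c * (4 * b * (1 - b * w.2) - 4 * b' * (1 - b' * w.2)) ^ 2 /
      (4 * (4 * b * (1 - b * w.2)) * (4 * b' * (1 - b' * w.2))),
    fun w => (Complex.I * (2 * (4 * b * (1 - b * w.2)) *
      (4 * b' * (1 - b' * w.2))) / (4 * b * (1 - b * w.2) - 4 * b' * (1 - b' * w.2))) * w.2 +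
      (Complex.I * (4 * b * (1 - b * w.2) +
      4 * b' * (1 - b' * w.2)) / (4 * b * (1 - b * w.2) - 4 * b' * (1 - b' * w.2))) * w.1 ^ 2,
    fun w => w.1, ?_, ?_, by fun_prop, ?_, ?_, rfl, ?_, ?_⟩
  · refine AnalyticAt.div (by fun_prop) (by fun_prop) ?_
    exact mul_ne_zero (mul_ne_zero (by norm_num) hA0.self_of_nhds) hB0.self_of_nhds
  · exact (hF.mul (by fun_prop)).add (hG.mul (by fun_prop))
  · exact div_ne_zero (mul_ne_zero (neg_ne_zero.2 hc) (pow_ne_zero 2 hD0.self_of_nhds))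
      (mul_ne_zero (mul_ne_zero (by norm_num) hA0.self_of_nhds) hB0.self_of_nhds)
  · simp
  · have hu := ((hF.differentiableAt.hasFDerivAt).mul h2).add
      ((hG.differentiableAt.hasFDerivAt).mul (h1.pow 2))
    have hu' := hu.fderiv
    simp only [Pi.mul_def, Pi.add_def] at hu'
    rw [hu', h1.fderiv]
    apply linearIndependent_pair_clm
    have := hA0.self_of_nhds
    have := hB0.self_of_nhds
    have := hD0.self_of_nhds
    simp_all [Complex.I_ne_zero]
  · filter_upwards [hA0, hB0, hD0] with w hA hB hD
    rw [hg]
    generalize hA' : 4 * b * (1 - b * w.2) = A at *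
    generalize hB' : 4 * b' * (1 - b' * w.2) = B at *
    have e1 : w.1 ^ 2 + 4 * (b * w.2) - 4 * (b * w.2) ^ 2 = w.1 ^ 2 + A * w.2 := by
      rw [← hA']; ring
    have e2 : w.1 ^ 2 + 4 * (b' * w.2) - 4 * (b' * w.2) ^ 2 = w.1 ^ 2 + B * w.2 := by
      rw [← hB']; ring
    rw [e1, e2]
    have : (Complex.I * (2 * A * B) / (A - B) * w.2 + Complex.I * (A + B) / (A - B) * w.1 ^ 2) ^ 2 =
        -(2 * A * B * w.2 + (A + B) * w.1 ^ 2) ^ 2 / (A - B) ^ 2 := by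
      field_simp
      linear_combination (2 * A * B * w.2 + (A + B) * w.1 ^ 2) ^ 2 * Complex.I_sq
    rw [this]
    field_simp
    ring

/-! ### Adapted coordinates and conics in transversal position -/

/-- The vector whose coordinates with indices `i`, `i + 1`, `i + 2` are `x`, `y / α`, `z / β`. -/
noncomputable def dualVec (i : Fin 3) (α β x y z : ℂ) : Fin 3 → ℂ :=
  fun j => if j = i then x else if j = i + 1 then y / α else z / β

theorem dualVec_self (i : Fin 3) (α β x y z : ℂ) : dualVec i α β x y z i = x := by
  simp [dualVec]

theorem dualVec_add_one (i : Fin 3) (α β x y z : ℂ) : dualVec i α β x y z (i + 1) = y / α := by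
  fin_cases i <;> simp [dualVec]

theorem dualVec_add_two (i : Fin 3) (α β x y z : ℂ) : dualVec i α β x y z (i + 2) = z / β := by
  fin_cases i <;> simp [dualVec]

theorem mul_dualVec_add_one (i : Fin 3) {α : ℂ} (hα : α ≠ 0) (β x y z : ℂ) :
    α * dualVec i α β x y z (i + 1) = y := by
  rw [dualVec_add_one, mul_div_cancel₀ _ hα]

theorem mul_dualVec_add_two (i : Fin 3) (α : ℂ) {β : ℂ} (hβ : β ≠ 0) (x y z : ℂ) :
    β * dualVec i α β x y z (i + 2) = z := by
  rw [dualVec_add_two, mul_div_cancel₀ _ hβ]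

theorem dualVec_eq (i : Fin 3) {α β : ℂ} (hα : α ≠ 0) (hβ : β ≠ 0) (v : Fin 3 → ℂ) :
    dualVec i α β (v i) (α * v (i + 1)) (β * v (i + 2)) = v := by
  funext j
  fin_cases i <;> fin_cases j <;> simp [dualVec, hα, hβ]

theorem dualVec_add_smul (i : Fin 3) (α β x y z x' y' z' x'' y'' z'' s t : ℂ) :
    dualVec i α β x y z + s • dualVec i α β x' y' z' + t • dualVec i α β x'' y'' z'' =
      dualVec i α β (x + s * x' + t * x'') (y + s * y' + t * y'') (z + s * z' + t * z'') := by
  funext j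
  simp only [dualVec, Pi.add_apply, Pi.smul_apply, smul_eq_mul]
  split_ifs <;> ring

theorem smul_dualVec (i : Fin 3) (α β x y z s : ℂ) :
    s • dualVec i α β x y z = dualVec i α β (s * x) (s * y) (s * z) := by
  funext j
  simp only [dualVec, Pi.smul_apply, smul_eq_mul]
  split_ifs <;> ring

theorem linearIndependent_dualVec (i : Fin 3) {α β : ℂ} (hα : α ≠ 0) (hβ : β ≠ 0)
    {x y z x' y' z' x'' y'' z'' : ℂ}
    (hdet : x * (y' * z'' - y'' * z') - x' * (y * z'' - y'' * z) + x'' * (y * z' - y' * z) ≠ 0) :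
    LinearIndependent ℂ
      ![dualVec i α β x y z, dualVec i α β x' y' z', dualVec i α β x'' y'' z''] := by
  rw [Fintype.linearIndependent_iff]
  intro g hg
  simp only [Fin.sum_univ_three, Matrix.cons_val_zero, Matrix.cons_val_one, Matrix.cons_val] at hg
  rw [smul_dualVec, dualVec_add_smul] at hg
  have e0 := congrFun hg i
  have e1 := congrArg (α * ·) (congrFun hg (i + 1))
  have e2 := congrArg (β * ·) (congrFun hg (i + 2))
  simp only [dualVec_self, mul_dualVec_add_one i hα, mul_dualVec_add_two i α hβ, Pi.zero_apply,
    mul_zero] at e0 e1 e2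
  have k0 : g 0 = 0 := (mul_eq_zero.1 (by
    linear_combination (y' * z'' - y'' * z') * e0 - (x' * z'' - x'' * z') * e1 +
      (x' * y'' - x'' * y') * e2 : _ * g 0 = 0)).resolve_left hdet
  have k1 : g 1 = 0 := (mul_eq_zero.1 (by
    linear_combination -(y * z'' - y'' * z) * e0 + (x * z'' - x'' * z) * e1 -
      (x * y'' - x'' * y) * e2 : _ * g 1 = 0)).resolve_left hdet
  have k2 : g 2 = 0 := (mul_eq_zero.1 (by
    linear_combination (y * z' - y' * z) * e0 - (x * z' - x' * z) * e1 +
      (x * y' - x' * y) * e2 : _ * g 2 = 0)).resolve_left hdet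
  intro j
  fin_cases j <;> assumption

theorem dualVec_ne_zero (i : Fin 3) {α β : ℂ} (hβ : β ≠ 0) {x y z : ℂ} (h : x ≠ 0 ∨ z ≠ 0) :
    dualVec i α β x y z ≠ 0 := by
  intro h0
  rcases h with h | h
  · exact h (by rw [← dualVec_self i α β x y z, h0, Pi.zero_apply])
  · exact h (by rw [← mul_dualVec_add_two i α hβ x y z, h0, Pi.zero_apply, mul_zero])

theorem eval_contactForm_dualVec (i : Fin 3) {α β : ℂ} (hα : α ≠ 0) (hβ : β ≠ 0) (x y z : ℂ) :
    eval (dualVec i α β x y z) (contactForm i α β) =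
      (x - y) ^ 2 + 2 * ((x + y) * z) - 4 * z ^ 2 := by
  rw [eval_contactForm, dualVec_self, mul_dualVec_add_one i hα, mul_dualVec_add_two i α hβ]

/-- The conic with coefficients `a`, `b`, `c`, `d`, `e`, `f` of `x²`, `y²`, `z²`, `xy`, `xz`, `yz`
is nowhere tangent to the parametrized conic `(1 + v - v² : 1 - v - v² : 1)`. -/
def IsTransversal (a b c d e f : ℂ) : Prop :=
  ∀ v : ℂ,
    (a + b + d) * v ^ 4 + (2 * b - 2 * a) * v ^ 3 + (-a - b - 3 * d - e - f) * v ^ 2 +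
      (2 * a - 2 * b + e - f) * v + (a + b + c + d + e + f) = 0 →
    4 * (a + b + d) * v ^ 3 + 3 * (2 * b - 2 * a) * v ^ 2 + 2 * (-a - b - 3 * d - e - f) * v +
      (2 * a - 2 * b + e - f) ≠ 0

theorem ncard_roots_of_isTransversal {a b c d e f : ℂ} (hT : IsTransversal a b c d e f)
    (h0 : a + b + d ≠ 0) :
    {v : ℂ | (a + b + d) * v ^ 4 + (2 * b - 2 * a) * v ^ 3 + (-a - b - 3 * d - e - f) * v ^ 2 +
      (2 * a - 2 * b + e - f) * v + (a + b + c + d + e + f) = 0}.ncard = 4 := by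
  obtain ⟨H, hH⟩ : ∃ H : Polynomial ℂ, H = Polynomial.C (a + b + d) * Polynomial.X ^ 4 +
    Polynomial.C (2 * b - 2 * a) * Polynomial.X ^ 3 +
    Polynomial.C (-a - b - 3 * d - e - f) * Polynomial.X ^ 2 +
    Polynomial.C (2 * a - 2 * b + e - f) * Polynomial.X +
    Polynomial.C (a + b + c + d + e + f) := ⟨_, rfl⟩
  have hdeg : H.natDegree = 4 := by
    rw [hH]
    compute_degree!
  have hne : H ≠ 0 := by
    rintro rfl
    simp at hdeg
  have hnodup : H.roots.Nodup := by
    rw [Multiset.nodup_iff_count_le_one]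
    intro v
    rw [Polynomial.count_roots]
    by_contra! hv
    obtain ⟨h1, h2⟩ := (Polynomial.one_lt_rootMultiplicity_iff_isRoot hne).1 hv
    rw [hH] at h1 h2
    simp only [Polynomial.IsRoot.def, Polynomial.derivative_add, Polynomial.derivative_mul,
      Polynomial.derivative_C, Polynomial.derivative_X_pow, Polynomial.derivative_X,
      Polynomial.eval_add, Polynomial.eval_mul, Polynomial.eval_C, Polynomial.eval_pow,
      Polynomial.eval_X, Polynomial.eval_zero, Polynomial.eval_one] at h1 h2
    refine hT v h1 ?_
    norm_num at h2
    linear_combination h2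
  have hset : {v : ℂ | (a + b + d) * v ^ 4 + (2 * b - 2 * a) * v ^ 3 +
      (-a - b - 3 * d - e - f) * v ^ 2 + (2 * a - 2 * b + e - f) * v +
      (a + b + c + d + e + f) = 0} = (H.roots.toFinset : Set ℂ) := by
    ext v
    rw [Finset.mem_coe, Multiset.mem_toFinset, Polynomial.mem_roots hne, hH]
    simp only [Polynomial.IsRoot.def, Polynomial.eval_add, Polynomial.eval_mul, Polynomial.eval_C,
      Polynomial.eval_pow, Polynomial.eval_X]
    rfl
  rw [hset, Set.ncard_coe_finset, Multiset.toFinset_card_of_nodup hnodup,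
    Polynomial.splits_iff_card_roots.1 (IsAlgClosed.splits H), hdeg]

/-- A conic that is nowhere tangent to a given smooth conic meets it in four nodes. -/
theorem commonPoints_of_isTransversal {Q' : Conic} {i : Fin 3} {α β : ℂ} (hα : α ≠ 0) (hβ : β ≠ 0)
    {a b c d e f t : ℂ} (ht : t ≠ 0)
    (hQ' : ∀ x y z, eval (dualVec i α β x y z) Q'.form =
      t * (a * x ^ 2 + b * y ^ 2 + c * z ^ 2 + d * (x * y) + e * (x * z) + f * (y * z)))
    (h0 : a + b + d ≠ 0) (hT : IsTransversal a b c d e f) :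
    (commonPoints (contactConic i α β) Q').ncard = 4 ∧
      ∀ p ∈ commonPoints (contactConic i α β) Q', IsNode (contactConic i α β) Q' p := by
  obtain ⟨s, hs, hQ⟩ := contactConic_form i α β
  have hQe : ∀ x y z, eval (dualVec i α β x y z) (contactConic i α β).form =
      s * ((x - y) ^ 2 + 2 * ((x + y) * z) - 4 * z ^ 2) := fun x y z => by
    rw [hQ, map_mul, eval_C, eval_contactForm_dualVec i hα hβ]
  have hne : ∀ v : ℂ, dualVec i α β (1 + v - v ^ 2) (1 - v - v ^ 2) 1 ≠ 0 := fun v =>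
    dualVec_ne_zero i hβ (Or.inr one_ne_zero)
  -- This parametrization, inverted by `v = (x - y) / (2z)`, misses only the point `(1 : 1 : 0)` of
  -- the first conic, and `a + b + d ≠ 0` says that the second conic avoids it.
  let P : ℂ → Plane := fun v => Projectivization.mk ℂ _ (hne v)
  let S : Set ℂ := {v : ℂ | (a + b + d) * v ^ 4 + (2 * b - 2 * a) * v ^ 3 +
    (-a - b - 3 * d - e - f) * v ^ 2 + (2 * a - 2 * b + e - f) * v + (a + b + c + d + e + f) = 0}
  have hPinj : Function.Injective P := by
    intro v w hvw
    obtain ⟨r, hr⟩ := (Projectivization.mk_eq_mk_iff' ℂ _ _ _ _).1 hvw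
    rw [smul_dualVec] at hr
    have e0 := congrFun hr i
    have e1 := congrArg (α * ·) (congrFun hr (i + 1))
    have e2 := congrArg (β * ·) (congrFun hr (i + 2))
    simp only [dualVec_self, mul_dualVec_add_one i hα, mul_dualVec_add_two i α hβ] at e0 e1 e2
    rw [mul_one] at e2
    subst e2
    linear_combination (e1 - e0) / 2
  have hset : commonPoints (contactConic i α β) Q' = P '' S := by
    ext p
    constructor
    · intro hp
      obtain ⟨x, hx⟩ : ∃ x, x = p.rep i := ⟨_, rfl⟩
      obtain ⟨y, hy⟩ : ∃ y, y = α * p.rep (i + 1) := ⟨_, rfl⟩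
      obtain ⟨z, hz⟩ : ∃ z, z = β * p.rep (i + 2) := ⟨_, rfl⟩
      have hrep : p.rep = dualVec i α β x y z := by rw [hx, hy, hz, dualVec_eq i hα hβ]
      have hp1 : eval p.rep (contactConic i α β).form = 0 := hp.1
      have hp2 : eval p.rep Q'.form = 0 := hp.2
      rw [hrep, hQe] at hp1
      rw [hrep, hQ'] at hp2
      replace hp1 := (mul_eq_zero.1 hp1).resolve_left hs
      replace hp2 := (mul_eq_zero.1 hp2).resolve_left ht
      have hz0 : z ≠ 0 := by
        rintro rfl
        have hxy : x = y := by
          have : (x - y) ^ 2 = 0 := by linear_combination hp1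
          exact sub_eq_zero.1 (pow_eq_zero_iff two_ne_zero |>.1 this)
        subst hxy
        have hx0 : x = 0 := by
          have : (a + b + d) * x ^ 2 = 0 := by linear_combination hp2
          exact pow_eq_zero_iff two_ne_zero |>.1 ((mul_eq_zero.1 this).resolve_left h0)
        subst hx0
        refine p.rep_nonzero (hrep.trans ?_)
        funext j
        simp [dualVec]
      have hX : x = z * (1 + (x - y) / (2 * z) - ((x - y) / (2 * z)) ^ 2) := by
        field_simp
        linear_combination hp1
      have hY : y = z * (1 - (x - y) / (2 * z) - ((x - y) / (2 * z)) ^ 2) := by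
        field_simp
        linear_combination hp1
      generalize (x - y) / (2 * z) = v at hX hY
      refine ⟨v, ?_, ?_⟩
      · have : z ^ 2 * ((a + b + d) * v ^ 4 + (2 * b - 2 * a) * v ^ 3 +
            (-a - b - 3 * d - e - f) * v ^ 2 + (2 * a - 2 * b + e - f) * v +
            (a + b + c + d + e + f)) = 0 := by
          rw [hX, hY] at hp2
          linear_combination hp2
        exact (mul_eq_zero.1 this).resolve_left (pow_ne_zero 2 hz0)
      · rw [← p.mk_rep]
        refine ((Projectivization.mk_eq_mk_iff' ℂ _ _ _ _).2 ⟨z, ?_⟩).symm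
        rw [smul_dualVec, ← hX, ← hY, mul_one, hrep]
    · rintro ⟨v, hv, rfl⟩
      refine (mem_commonPoints_mk_iff _ _ (hne v)).2 ⟨?_, ?_⟩
      · rw [hQe]
        ring
      · rw [hQ', mul_eq_zero]
        right
        have hv0 : (a + b + d) * v ^ 4 + (2 * b - 2 * a) * v ^ 3 +
          (-a - b - 3 * d - e - f) * v ^ 2 + (2 * a - 2 * b + e - f) * v +
          (a + b + c + d + e + f) = 0 := hv
        linear_combination hv0
  constructor
  · rw [hset, Set.ncard_image_of_injective _ hPinj]
    exact ncard_roots_of_isTransversal hT h0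
  · rw [hset]
    rintro _ ⟨v, hv, rfl⟩
    have hv0 : (a + b + d) * v ^ 4 + (2 * b - 2 * a) * v ^ 3 +
      (-a - b - 3 * d - e - f) * v ^ 2 + (2 * a - 2 * b + e - f) * v +
      (a + b + c + d + e + f) = 0 := hv
    -- The first chart direction is the velocity of the parametrization. The first conic becomes `4
    -- w.2 + 4 w.1 ^ 2` up to a scalar, and the `w.1` coefficient of the second is the derivative of
    -- the quartic at `v`, so simplicity of the root is transversality.
    refine ⟨_, dualVec i α β (1 - 2 * v) (-1 - 2 * v) 0, dualVec i α β 1 1 0,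
      mem_submodule_mk (hne v), linearIndependent_dualVec i hα hβ ?_, ?_⟩
    · ring_nf
      norm_num
    · refine isGermOfTypeA_one_of_transversal (c := s * t) (l := 0) (m := 4) (x := 4) (y := 0)
        (z := 0) (l' := 4 * (a + b + d) * v ^ 3 + 3 * (2 * b - 2 * a) * v ^ 2 +
          2 * (-a - b - 3 * d - e - f) * v + (2 * a - 2 * b + e - f))
        (m' := 2 * a * (1 + v - v ^ 2) + 2 * b * (1 - v - v ^ 2) + d * (2 - 2 * v ^ 2) + e + f)
        (x' := a * (1 - 2 * v) ^ 2 + b * (-1 - 2 * v) ^ 2 + d * ((1 - 2 * v) * (-1 - 2 * v)))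
        (y' := 2 * a * (1 - 2 * v) + 2 * b * (-1 - 2 * v) + d * (-4 * v)) (z' := a + b + d)
        (mul_ne_zero hs ht) ?_ ?_
      · have := hT v hv0
        simpa using this
      · intro w
        rw [dualVec_add_smul, map_mul, hQe, hQ']
        linear_combination s * t * (4 * w.2 + 4 * w.1 ^ 2) * hv0

/-! ### Bézout certificates for transversality -/

/-- This and the next four lemmas cover the relative positions of conics of different classes with
equal or cyclically consecutive indices. In each, a nonzero integer is an explicit combination of
the quartic, its derivative and the relations on the parameters, so a double root is impossible. -/
theorem isTransversal_same_one {t : ℂ} (ht : t ^ 2 + t + 1 = 0) : IsTransversal 1 (t ^ 2)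
    (-4) (-2 * t) 2 (2 * t) := by
  intro v h h'
  have key : (30 : ℂ) = 0 := by
    linear_combination
      (362 + 232 * t - 72 * v + 288 * v * t - 408
      * v ^ 2) * h + (87 + 99 * t - 211 * v - 110 * v * t + v ^ 2 - 106 * v ^ 2 * t + 102 * v ^
      3) * h' + (44 - 34 * t - 154 * v + 154 * v * t + 218 * v ^ 2 - 218 * v ^ 2 * t + 124 * v ^ 3
      - 124 * v ^ 3 * t - 268 * v ^ 4 + 268 * v ^ 4 * t - 136 * v ^ 5 + 136 * v ^ 5 * t) * ht
  norm_num at key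

theorem isTransversal_same_self {t : ℂ} (ht : t ^ 2 + t + 1 = 0) : IsTransversal 1 (t ^ 2)
    (-4 * t ^ 2) (-2 * t) (2 * t) (2 * t ^ 2) := by
  intro v h h'
  have key : (30 : ℂ) = 0 := by
    linear_combination
      (232 + 362 * t - 288 * v + 72 * v * t - 408
      * v ^ 2 * t) * h + (-99 - 87 * t - 110 * v - 211 * v * t + 106 * v ^ 2 - v ^ 2 * t + 102
      * v ^ 3 * t) * h' + (-4 + 14 * t - 154 * v + 154 * v * t - 218 * v ^ 2 + 218 * v ^ 2 * t +
      124 * v ^ 3 - 124 * v ^ 3 * t + 268 * v ^ 4 - 268 * v ^ 4 * t - 136 * v ^ 5 + 136 * v ^ 5 *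
      t) * ht
  norm_num at key

theorem isTransversal_same_sq {t : ℂ} (ht : t ^ 2 + t + 1 = 0) : IsTransversal 1 (t ^ 2) (-4
    * t ^ 4) (-2 * t) (2 * t ^ 2) (2 * t ^ 3) := by
  intro v h h'
  have key : (1782 : ℂ) = 0 := by
    linear_combination
      (198 + 198 * t - 72 * v + 72 * v * t + 24
      * v ^ 2 + 24 * v ^ 2 * t) * h + (-36 + 36 * t - 51 * v - 51 * v * t + 17 * v ^ 2 - 17 * v ^ 2
      * t - 6 * v ^ 3 - 6 * v ^ 3 * t) * h' + (1656 - 1530 * t - 324 * t ^ 2 + 792 * t ^ 3 - 294 *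
      v + 288 * v * t - 282 * v * t ^ 2 + 288 * v * t ^ 3 - 34 * v ^ 2 - 316 * v ^ 2 * t + 254 * v
      ^ 2 * t ^ 2 + 96 * v ^ 2 * t ^ 3 + 160 * v ^ 3 - 272 * v ^ 3 * t + 112 * v ^ 3 * t ^ 2 - 24 *
      v ^ 4 + 24 * v ^ 4 * t ^ 2 + 16 * v ^ 5 - 16 * v ^ 5 * t) * ht
  norm_num at key

theorem isTransversal_next_one {m : ℂ} (hm : m ^ 3 + 4 = 0) : IsTransversal (-m ^ 2) 1
    (-m) m 2 (m ^ 2) := by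
  intro v h h'
  have key : (27324 : ℂ) = 0 := by
    linear_combination
      (7812 - 41796 * m + 11448 * m ^ 2 + 27792
      * v + 6744 * v * m + 36852 * v * m ^ 2 - 5200 * v ^ 2 + 3328 * v ^ 2 * m - 36376 * v ^ 2 * m
      ^ 2) * h + (11448 + 324 * m + 10449 * m ^ 2 + 7494 * v + 19674 * v * m - 7248 * v * m ^ 2 -
      14878 * v ^ 2 - 1772 * v ^ 2 * m - 11860 * v ^ 2 * m ^ 2 + 1300 * v ^ 3 - 832 * v ^ 3 * m +
      9094 * v ^ 3 * m ^ 2) * h' + (972 + 31347 * m - 3672 * v + 12600 * v * m + 3828 * v ^ 2 +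
      12282 * v ^ 2 * m - 28068 * v ^ 3 - 19458 * v ^ 3 * m - 2976 * v ^ 4 - 20088 * v ^ 4 * m +
      8580 * v ^ 5 + 7600 * v ^ 5 * m) * hm
  norm_num at key

theorem isTransversal_next {t m : ℂ} (ht : t ^ 2 + t + 1 = 0) (hm : m ^ 3 + 4 = 0) :
    IsTransversal (-m ^ 2) 1 (-t ^ 2 * m) m (2 * t) (t * m ^ 2) := by
  intro v h h'
  have key : (5652 : ℂ) = 0 := by
    linear_combination
      (-1123920 - 432408 * m + 172632 * m ^ 2 -
      688164 * t + 275052 * t * m + 445668 * t * m ^ 2 + 1436608 * v + 2726376 * v * m + 1150100 *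
      v * m ^ 2 + 4331504 * v * t + 1823088 * v * t * m - 568772 * v * t * m ^ 2 + 5275168 * v ^ 2
      - 367632 * v ^ 2 * m - 2326024 * v ^ 2 * m ^ 2 - 585008 * v ^ 2 * t - 3691664 * v ^ 2 * t * m
      - 2094120 * v ^ 2 * t * m ^ 2) * h + (-86442 + 36048 * m + 57675 * m ^ 2 + 58116 * t + 90996
      * t * m + 34581 * t * m ^ 2 + 786764 * v + 311948 * v * m - 115686 * v * m ^ 2 + 495370 * v *
      t - 183806 * v * t * m - 312240 * v * t * m ^ 2 - 491192 * v ^ 2 - 1020832 * v ^ 2 * m -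
      448970 * v ^ 2 * m ^ 2 - 1621610 * v ^ 2 * t - 711940 * v ^ 2 * t * m + 194518 * v ^ 2 * t *
      m ^ 2 - 1318792 * v ^ 3 + 91908 * v ^ 3 * m + 581506 * v ^ 3 * m ^ 2 + 146252 * v ^ 3 * t +
      922916 * v ^ 3 * t * m + 523530 * v ^ 3 * t * m ^ 2) * h' + (3088464 + 476496 * m - 921678 *
      m ^ 2 - 1782672 * t - 688164 * t * m + 275052 * t * m ^ 2 - 8721044 * v - 9445028 * v * m -
      2495766 * v * m ^ 2 + 2275088 * v * t + 4331504 * v * t * m + 1823088 * v * t * m ^ 2 -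
      21558012 * v ^ 2 + 4671872 * v ^ 2 * m + 11500634 * v ^ 2 * m ^ 2 + 8376480 * v ^ 2 * t -
      585008 * v ^ 2 * t * m - 3691664 * v ^ 2 * t * m ^ 2 + 12532240 * v ^ 3 + 13337216 * v ^ 3 *
      m + 3431236 * v ^ 3 * m ^ 2 + 6798320 * v ^ 4 + 496576 * v ^ 4 * m - 2386624 * v ^ 4 * m ^ 2)
      * ht + (-532944 + 287982 * m + 479832 * t + 399873 * t * m - 11424 * t ^ 2 - 411087 * t ^ 2 *
      m + 445668 * t ^ 3 + 1609310 * v + 1148642 * v * m - 174894 * v * t - 1348882 * v * t * m -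
      399750 * v * t ^ 2 + 771362 * v * t ^ 2 * m - 568772 * v * t ^ 3 + 4785484 * v ^ 2 - 1211074
      * v ^ 2 * m + 1899564 * v ^ 2 * t + 97112 * v ^ 2 * t * m + 2384228 * v ^ 2 * t ^ 2 + 1541054
      * v ^ 2 * t ^ 2 * m - 2094120 * v ^ 2 * t ^ 3 - 1573060 * v ^ 3 - 3161644 * v ^ 3 * m -
      5288532 * v ^ 3 * t - 3333374 * v ^ 3 * t * m - 2369540 * v ^ 3 * t ^ 2 - 1750326 * v ^ 3 * t
      ^ 2 * m - 1527484 * v ^ 4 + 1266520 * v ^ 4 * m - 510580 * v ^ 4 * t - 948808 * v ^ 4 * t * m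
      - 1845832 * v ^ 4 * t ^ 2 - 1047060 * v ^ 4 * t ^ 2 * m - 527356 * v ^ 5 + 517232 * v ^ 5 * m
      + 611860 * v ^ 5 * t + 1256360 * v ^ 5 * t * m) * hm
  norm_num at key

/-! ### The nine points and the classes -/

/-- Eliminating between the quadratic and the cubic relations forces `y = -(5/4) x`, where the
quadratic takes the value `-(31/4) x²`. This excludes every accidental passage of a contact conic
through one of the nine points. -/
theorem sq_add_sub_ne_zero {x y : ℂ} (hx : x ^ 3 = 1) (hy : 2 * y ^ 3 = -1) :
    x ^ 2 + 2 * (x * y) - 4 * y ^ 2 ≠ 0 := by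
  intro h
  have hxy : x ^ 2 * y = -(5 / 4) := by
    linear_combination hy - hx / 4 + (y / 2 + x / 4) * h
  have hy' : y = -(5 / 4) * x := by linear_combination x * hxy - y * hx
  rw [hy'] at h
  have hx2 : x ^ 2 = 0 := by linear_combination -(4 / 31) * h
  have : x = 0 := pow_eq_zero_iff two_ne_zero |>.1 hx2
  subst this
  norm_num at hx

/-- The index of the coordinate of the point `p_n` that is normalized to `1`. -/
def pointIndex : Fin 9 → Fin 3 := ![0, 0, 0, 1, 1, 1, 2, 2, 2]

/-- The exponent of `ω` in the coordinates of the point `p_n`. -/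
def pointExponent : Fin 9 → ℕ := ![0, 1, 2, 0, 1, 2, 0, 1, 2]

theorem ninePointCoords_eq (ω : ℂ) (n : Fin 9) :
    ninePointCoords ω n = dualVec (pointIndex n) 1 1 1 (ω ^ pointExponent n) 0 := by
  funext j
  fin_cases n <;> fin_cases j <;> simp [ninePointCoords, dualVec, pointIndex, pointExponent]

/-- If `i` is the index of the point, `Z` vanishes there and the form reduces to `(1 - α ε)²`.
Otherwise `X` or `Y` vanishes and the value has the shape excluded by `sq_add_sub_ne_zero`. -/
theorem passesThrough_ninePoint_iff {ω : ℂ} (hω : ω ^ 3 = 1) (n : Fin 9) {i : Fin 3} {α β : ℂ}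
    (hα : α ^ 3 = 1) (hβ : 2 * β ^ 3 = -1) :
    PassesThrough (contactConic i α β).form (ninePoint ω n) ↔
      i = pointIndex n ∧ α * ω ^ pointExponent n = 1 := by
  obtain ⟨c, hc, hform⟩ := contactConic_form i α β
  have hε : (ω ^ pointExponent n) ^ 3 = 1 := by rw [← pow_mul, mul_comm, pow_mul, hω, one_pow]
  rw [ninePoint, passesThrough_mk_iff (Conic.form_isHomogeneous _), hform, map_mul, eval_C,
    mul_eq_zero, or_iff_right hc, eval_contactForm, ninePointCoords_eq]
  generalize ω ^ pointExponent n = ε at hε ⊢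
  generalize pointIndex n = k
  have e0 : dualVec k 1 1 1 ε 0 k = 1 := dualVec_self _ _ _ _ _ _
  have e1 : dualVec k 1 1 1 ε 0 (k + 1) = ε := by
    rw [dualVec_add_one, div_one]
  have e2 : dualVec k 1 1 1 ε 0 (k + 2) = 0 := by
    rw [dualVec_add_two, div_one]
  have hi : i = k ∨ i = k + 1 ∨ i = k + 2 :=
    (by decide : ∀ i k : Fin 3, i = k ∨ i = k + 1 ∨ i = k + 2) i k
  rcases hi with rfl | rfl | rfl
  · rw [e0, e1, e2]
    constructor
    · intro h
      have : (1 - α * ε) ^ 2 = 0 := by linear_combination h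
      exact ⟨rfl, (sub_eq_zero.1 (pow_eq_zero_iff two_ne_zero |>.1 this)).symm⟩
    · rintro ⟨-, h⟩
      rw [h]
      ring
  · have k1 : k + 1 + 1 = k + 2 := (by decide : ∀ k : Fin 3, k + 1 + 1 = k + 2) k
    have k2 : k + 1 + 2 = k := (by decide : ∀ k : Fin 3, k + 1 + 2 = k) k
    have k3 : k + 1 ≠ k := (by decide : ∀ k : Fin 3, k + 1 ≠ k) k
    rw [k1, k2, e0, e1, e2]
    simp only [k3, false_and, iff_false]
    intro h
    exact sq_add_sub_ne_zero hε hβ (by linear_combination h)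
  · have k1 : k + 2 + 1 = k := (by decide : ∀ k : Fin 3, k + 2 + 1 = k) k
    have k2 : k + 2 + 2 = k + 1 := (by decide : ∀ k : Fin 3, k + 2 + 2 = k + 1) k
    have k3 : k + 2 ≠ k := (by decide : ∀ k : Fin 3, k + 2 ≠ k) k
    rw [k1, k2, e0, e1, e2]
    simp only [k3, false_and, iff_false]
    intro h
    refine sq_add_sub_ne_zero hα (y := β * ε) ?_ (by linear_combination h)
    linear_combination ε ^ 3 * hβ - hε

/-- On `Y = 0` the `x²` coefficient fixes the scalar between the two equations, and the `xz`
coefficient then recovers `β`. -/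
theorem contactConic_injective (i : Fin 3) (α : ℂ) :
    Function.Injective (contactConic i α) := by
  intro β β' h
  obtain ⟨c, hc, hf⟩ := contactConic_form i α β
  obtain ⟨c', -, hf'⟩ := contactConic_form i α β'
  have key : ∀ x z : ℂ, c * (x ^ 2 + 2 * (x * (β * z)) - 4 * (β * z) ^ 2) =
      c' * (x ^ 2 + 2 * (x * (β' * z)) - 4 * (β' * z) ^ 2) := by
    intro x z
    have := congrArg (eval (dualVec i 1 1 x 0 z)) (hf.symm.trans ((congrArg _ h).trans hf'))
    have e1 : dualVec i 1 1 x 0 z (i + 1) = 0 := by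
      rw [dualVec_add_one, div_one]
    have e2 : dualVec i 1 1 x 0 z (i + 2) = z := by
      rw [dualVec_add_two, div_one]
    simp only [map_mul, eval_C, eval_contactForm, dualVec_self, e1, e2] at this
    linear_combination this
  have hcc : c = c' := by linear_combination key 1 0
  subst hcc
  refine mul_left_cancel₀ hc ?_
  linear_combination (key 1 1 - key (-1) 1) / 4

theorem root_ne_zero {β : ℂ} (hβ : 2 * β ^ 3 = -1) : β ≠ 0 := by
  rintro rfl
  norm_num at hβ

theorem ncard_roots {ω : ℂ} (hω : IsPrimitiveRoot ω 3) :
    {β : ℂ | 2 * β ^ 3 = -1}.ncard = 3 := by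
  obtain ⟨b, hb⟩ := IsAlgClosed.exists_pow_nat_eq (-1 / 2 : ℂ) (n := 3) (by norm_num)
  have hb' : 2 * b ^ 3 = -1 := by rw [hb]; norm_num
  have hb0 := root_ne_zero hb'
  have h3 := hω.pow_eq_one
  have h1 : ω ≠ 1 := hω.ne_one (by norm_num)
  have hω0 : ω ≠ 0 := hω.ne_zero (by norm_num)
  have h2 : ω ^ 2 + ω + 1 = 0 := by
    have : (ω - 1) * (ω ^ 2 + ω + 1) = 0 := by linear_combination h3
    exact (mul_eq_zero.1 this).resolve_left (sub_ne_zero.2 h1)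
  have hs : {β : ℂ | 2 * β ^ 3 = -1} = {b, ω * b, ω ^ 2 * b} := by
    ext β
    simp only [Set.mem_ofPred_eq, Set.mem_insert_iff, Set.mem_singleton_iff]
    constructor
    · intro h
      have : (β - b) * ((β - ω * b) * (β - ω ^ 2 * b)) = 0 := by
        linear_combination h / 2 - hb' / 2 - (β ^ 2 * b - β * b ^ 2 * ω) * h2 - b ^ 3 * h3
      rcases mul_eq_zero.1 this with h | h
      · exact Or.inl (sub_eq_zero.1 h)
      · rcases mul_eq_zero.1 h with h | h
        · exact Or.inr (Or.inl (sub_eq_zero.1 h))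
        · exact Or.inr (Or.inr (sub_eq_zero.1 h))
    · rintro (rfl | rfl | rfl)
      · exact hb'
      · linear_combination hb' + 2 * b ^ 3 * h3
      · linear_combination hb' + 2 * b ^ 3 * (ω ^ 3 + 1) * h3
  rw [hs, Set.ncard_eq_three]
  refine ⟨b, ω * b, ω ^ 2 * b, ?_, ?_, ?_, rfl⟩
  · intro h
    exact h1 (mul_right_cancel₀ hb0 (by linear_combination -h))
  · intro h
    have : ω ^ 2 = 1 := mul_right_cancel₀ hb0 (by linear_combination -h)
    exact h1 (by linear_combination h3 - ω * this)
  · intro h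
    exact h1 (mul_left_cancel₀ hω0 (mul_right_cancel₀ hb0 (by linear_combination -h)))

/-- Passing through the point fixes `i` and `α` and leaves `β` free; the exponent `2 * pointExponent
n` is `-pointExponent n` modulo 3. -/
theorem conicClass_eq {ω : ℂ} (hω : IsPrimitiveRoot ω 3) (n : Fin 9) :
    conicClass ω n = contactConic (pointIndex n) (ω ^ (2 * pointExponent n)) ''
      {β | 2 * β ^ 3 = -1} := by
  have h3 := hω.pow_eq_one
  have hε : ω ^ (3 * pointExponent n) = 1 := by rw [pow_mul, h3, one_pow]
  have hε0 : ω ^ pointExponent n ≠ 0 := pow_ne_zero _ (hω.ne_zero (by norm_num))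
  have hinv : ω ^ (2 * pointExponent n) * ω ^ pointExponent n = 1 := by
    rw [← pow_add, ← hε]
    ring
  ext Q
  constructor
  · rintro ⟨hQ, hp⟩
    obtain ⟨i, α, β, hα, hβ, rfl⟩ := (mem_fermatConics_iff Q).1 hQ
    obtain ⟨rfl, hαe⟩ := (passesThrough_ninePoint_iff h3 n hα hβ).1 hp
    refine ⟨β, hβ, ?_⟩
    rw [mul_right_cancel₀ hε0 (hαe.trans hinv.symm)]
  · rintro ⟨β, hβ, rfl⟩
    have hα : (ω ^ (2 * pointExponent n)) ^ 3 = 1 := by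
      rw [← pow_mul, mul_comm, pow_mul, h3, one_pow]
    exact ⟨(mem_fermatConics_iff _).2 ⟨_, _, _, hα, hβ, rfl⟩,
      (passesThrough_ninePoint_iff h3 n hα hβ).2 ⟨rfl, hinv⟩⟩

theorem ncard_conicClass {ω : ℂ} (hω : IsPrimitiveRoot ω 3) (n : Fin 9) :
    (conicClass ω n).ncard = 3 := by
  rw [conicClass_eq hω, Set.ncard_image_of_injective _ (contactConic_injective _ _),
    ncard_roots hω]

theorem iUnion_conicClass {ω : ℂ} (hω : IsPrimitiveRoot ω 3) :
    (⋃ j, conicClass ω j) = fermatConics := by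
  apply subset_antisymm
  · exact Set.iUnion_subset fun j Q hQ => hQ.1
  · intro Q hQ
    obtain ⟨i, α, β, hα, hβ, rfl⟩ := (mem_fermatConics_iff Q).1 hQ
    obtain ⟨k, hk, rfl⟩ := hω.eq_pow_of_pow_eq_one hα
    obtain ⟨n, rfl, hn⟩ : ∃ n, pointIndex n = i ∧ 3 ∣ k + pointExponent n := by
      clear hQ
      revert i
      interval_cases k <;> decide
    refine Set.mem_iUnion.2 ⟨n, hQ, ?_⟩
    rw [passesThrough_ninePoint_iff hω.pow_eq_one n hα hβ]
    refine ⟨rfl, ?_⟩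
    rw [← pow_add]
    exact (hω.pow_eq_one_iff_dvd _).2 hn

theorem eq_of_pointIndex_eq {ω : ℂ} (hω : IsPrimitiveRoot ω 3) {m n : Fin 9}
    (hi : pointIndex m = pointIndex n)
    (he : ω ^ (2 * pointExponent m) * ω ^ pointExponent n = 1) : m = n := by
  rw [← pow_add, hω.pow_eq_one_iff_dvd] at he
  revert m n
  decide

theorem disjoint_conicClass {ω : ℂ} (hω : IsPrimitiveRoot ω 3) {m n : Fin 9} (hmn : m ≠ n) :
    Disjoint (conicClass ω m) (conicClass ω n) := by
  rw [Set.disjoint_left]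
  intro Q hm hn
  rw [conicClass_eq hω] at hm
  obtain ⟨β, hβ, rfl⟩ := hm
  have hα : (ω ^ (2 * pointExponent m)) ^ 3 = 1 := by
    rw [← pow_mul, mul_comm, pow_mul, hω.pow_eq_one, one_pow]
  obtain ⟨hi, he⟩ := (passesThrough_ninePoint_iff hω.pow_eq_one n hα hβ).1 hn.2
  exact hmn (eq_of_pointIndex_eq hω hi he)

theorem ncard_fermatConics {ω : ℂ} (hω : IsPrimitiveRoot ω 3) : fermatConics.ncard = 27 := by
  rw [← iUnion_conicClass hω, Set.ncard_iUnion_of_finite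
    (fun n => Set.finite_of_ncard_ne_zero (by rw [ncard_conicClass hω]; norm_num))
    (fun m n hmn => disjoint_conicClass hω hmn)]
  simp [ncard_conicClass hω, finsum_eq_sum_of_fintype]

/-! ### Intersections of pairs of conics -/

/-- Two contact conics that differ only in `β` touch at one point and meet in two further nodes. -/
theorem commonPoints_same_class (i : Fin 3) {α β β' : ℂ} (hα : α ≠ 0) (hβ : β ≠ 0) (hβ' : β' ≠ 0)
    (hne : β ≠ β') :
    ∃ n₁ n₂ t : Plane, n₁ ≠ n₂ ∧ n₁ ≠ t ∧ n₂ ≠ t ∧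
      commonPoints (contactConic i α β) (contactConic i α β') = {n₁, n₂, t} ∧
      IsNode (contactConic i α β) (contactConic i α β') n₁ ∧
      IsNode (contactConic i α β) (contactConic i α β') n₂ ∧
      IsTacnode (contactConic i α β) (contactConic i α β') t := by
  -- The last coordinate stays unscaled (third parameter `1` in `dualVec`), so that both conics are
  -- written symmetrically in the same coordinates.
  have ev : ∀ b : ℂ, ∃ s : ℂ, s ≠ 0 ∧ ∀ x y z, eval (dualVec i α 1 x y z)
      (contactConic i α b).form = s * ((x - y) ^ 2 + 2 * ((x + y) * (b * z)) - 4 * (b * z) ^ 2) := by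
    intro b
    obtain ⟨s, hs, hf⟩ := contactConic_form i α b
    refine ⟨s, hs, fun x y z => ?_⟩
    have e2 : dualVec i α 1 x y z (i + 2) = z := by
      rw [dualVec_add_two, div_one]
    rw [hf, map_mul, eval_C, eval_contactForm, dualVec_self, mul_dualVec_add_one i hα, e2]
  obtain ⟨s, hs, hQ⟩ := ev β
  obtain ⟨s', hs', hQ'⟩ := ev β'
  have hsub : β - β' ≠ 0 := sub_ne_zero.2 hne
  -- The difference of the equations is `2(β - β') z (x + y - 2(β + β') z)`. On the second factor
  -- `(x - y)² = -4ββ' z²`, so the nodes have `x - y = ±2δz`; on `z = 0` only the tacnode `(1 : 1 :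
  -- 0)` remains.
  obtain ⟨δ, hδ⟩ := IsAlgClosed.exists_pow_nat_eq (-(β * β')) (n := 2) (by norm_num)
  have hδ0 : δ ≠ 0 := by
    rintro rfl
    have : β * β' = 0 := by linear_combination hδ
    exact (mul_ne_zero hβ hβ') this
  have hN : ∀ ε : ℂ, dualVec i α 1 (β + β' + ε) (β + β' - ε) 1 ≠ 0 := fun ε =>
    dualVec_ne_zero i one_ne_zero (Or.inr one_ne_zero)
  have hT : dualVec i α 1 1 1 0 ≠ 0 := dualVec_ne_zero i one_ne_zero (Or.inl one_ne_zero)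
  have hnode : ∀ ε : ℂ, ε ≠ 0 → ε ^ 2 = -(β * β') →
      IsNode (contactConic i α β) (contactConic i α β') (Projectivization.mk ℂ _ (hN ε)) := by
    intro ε hε0 hε
    refine ⟨_, dualVec i α 1 1 1 0, dualVec i α 1 1 (-1) 0, mem_submodule_mk (hN ε),
      linearIndependent_dualVec i hα one_ne_zero (by ring_nf; norm_num), ?_⟩
    refine isGermOfTypeA_one_of_transversal (c := s * s') (l := 4 * β) (m := 8 * ε) (x := 0)
      (y := 0) (z := 4) (l' := 4 * β') (m' := 8 * ε) (x' := 0) (y' := 0) (z' := 4)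
      (mul_ne_zero hs hs') ?_ ?_
    · have : 4 * β * (8 * ε) - 8 * ε * (4 * β') = 32 * (ε * (β - β')) := by ring
      rw [this]
      exact mul_ne_zero (by norm_num) (mul_ne_zero hε0 hsub)
    · intro w
      rw [dualVec_add_smul, map_mul, hQ, hQ']
      have e1 : (β + β' + ε + w.1 * 1 + w.2 * 1 - (β + β' - ε + w.1 * 1 + w.2 * -1)) ^ 2 +
          2 * ((β + β' + ε + w.1 * 1 + w.2 * 1 + (β + β' - ε + w.1 * 1 + w.2 * -1)) *
            (β * (1 + w.1 * 0 + w.2 * 0))) - 4 * (β * (1 + w.1 * 0 + w.2 * 0)) ^ 2 =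
          4 * β * w.1 + 8 * ε * w.2 + (0 * w.1 ^ 2 + 0 * (w.1 * w.2) + 4 * w.2 ^ 2) := by
        linear_combination 4 * hε
      have e2 : (β + β' + ε + w.1 * 1 + w.2 * 1 - (β + β' - ε + w.1 * 1 + w.2 * -1)) ^ 2 +
          2 * ((β + β' + ε + w.1 * 1 + w.2 * 1 + (β + β' - ε + w.1 * 1 + w.2 * -1)) *
            (β' * (1 + w.1 * 0 + w.2 * 0))) - 4 * (β' * (1 + w.1 * 0 + w.2 * 0)) ^ 2 =
          4 * β' * w.1 + 8 * ε * w.2 + (0 * w.1 ^ 2 + 0 * (w.1 * w.2) + 4 * w.2 ^ 2) := by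
        linear_combination 4 * hε
      rw [e1, e2]
      ring
  have hne_t : ∀ ε : ℂ, Projectivization.mk ℂ _ (hN ε) ≠ Projectivization.mk ℂ _ hT := by
    intro ε h
    obtain ⟨r, hr⟩ := (Projectivization.mk_eq_mk_iff' ℂ _ _ _ _).1 h
    have e2 := congrArg ((1 : ℂ) * ·) (congrFun hr (i + 2))
    simp only [smul_dualVec, mul_dualVec_add_two i α one_ne_zero] at e2
    norm_num at e2
  have hmem : ∀ ε : ℂ, ε ^ 2 = -(β * β') → Projectivization.mk ℂ _ (hN ε) ∈
      commonPoints (contactConic i α β) (contactConic i α β') := by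
    intro ε hε
    rw [mem_commonPoints_mk_iff, hQ, hQ']
    constructor
    · linear_combination 4 * s * hε
    · linear_combination 4 * s' * hε
  refine ⟨Projectivization.mk ℂ _ (hN δ), Projectivization.mk ℂ _ (hN (-δ)),
    Projectivization.mk ℂ _ hT, ?_, hne_t δ, hne_t (-δ), ?_, hnode δ hδ0 hδ,
    hnode (-δ) (neg_ne_zero.2 hδ0) (by rw [neg_sq, hδ]), ?_⟩
  · intro h
    obtain ⟨r, hr⟩ := (Projectivization.mk_eq_mk_iff' ℂ _ _ _ _).1 h
    rw [smul_dualVec] at hr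
    have e0 := congrFun hr i
    have e2 := congrArg ((1 : ℂ) * ·) (congrFun hr (i + 2))
    simp only [dualVec_self, mul_dualVec_add_two i α one_ne_zero, mul_one] at e0 e2
    subst e2
    exact hδ0 (by linear_combination -e0 / 2)
  · ext p
    simp only [Set.mem_insert_iff, Set.mem_singleton_iff]
    constructor
    · intro hp
      obtain ⟨x, hx⟩ : ∃ x, x = p.rep i := ⟨_, rfl⟩
      obtain ⟨y, hy⟩ : ∃ y, y = α * p.rep (i + 1) := ⟨_, rfl⟩
      obtain ⟨z, hz⟩ : ∃ z, z = 1 * p.rep (i + 2) := ⟨_, rfl⟩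
      have hrep : p.rep = dualVec i α 1 x y z := by rw [hx, hy, hz, dualVec_eq i hα one_ne_zero]
      have hp1 : eval p.rep (contactConic i α β).form = 0 := hp.1
      have hp2 : eval p.rep (contactConic i α β').form = 0 := hp.2
      rw [hrep, hQ] at hp1
      rw [hrep, hQ'] at hp2
      replace hp1 := (mul_eq_zero.1 hp1).resolve_left hs
      replace hp2 := (mul_eq_zero.1 hp2).resolve_left hs'
      by_cases hz0 : z = 0
      · subst hz0
        have hxy : y = x := by
          have : (x - y) ^ 2 = 0 := by linear_combination hp1
          exact (sub_eq_zero.1 (pow_eq_zero_iff two_ne_zero |>.1 this)).symm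
        right; right
        rw [← p.mk_rep]
        refine (Projectivization.mk_eq_mk_iff' ℂ _ _ _ _).2 ⟨x, ?_⟩
        rw [smul_dualVec, hrep, hxy, mul_one, mul_zero]
      · have hsum : x + y = 2 * (β + β') * z := by
          have : (2 * (β - β') * z) * (x + y - 2 * (β + β') * z) = 0 := by
            linear_combination hp1 - hp2
          exact sub_eq_zero.1 ((mul_eq_zero.1 this).resolve_left
            (mul_ne_zero (mul_ne_zero two_ne_zero hsub) hz0))
        have hdiff : (x - y - 2 * δ * z) * (x - y + 2 * δ * z) = 0 := by
          linear_combination hp1 - 2 * β * z * hsum - 4 * z ^ 2 * hδ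
        rcases mul_eq_zero.1 hdiff with h | h
        · left
          rw [← p.mk_rep]
          refine (Projectivization.mk_eq_mk_iff' ℂ _ _ _ _).2 ⟨z, ?_⟩
          have ex : z * (β + β' + δ) = x := by linear_combination -hsum / 2 - h / 2
          have ey : z * (β + β' - δ) = y := by linear_combination -hsum / 2 + h / 2
          rw [smul_dualVec, hrep, ex, ey, mul_one]
        · right; left
          rw [← p.mk_rep]
          refine (Projectivization.mk_eq_mk_iff' ℂ _ _ _ _).2 ⟨z, ?_⟩
          have ex : z * (β + β' + -δ) = x := by linear_combination -hsum / 2 - h / 2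
          have ey : z * (β + β' - -δ) = y := by linear_combination -hsum / 2 + h / 2
          rw [smul_dualVec, hrep, ex, ey, mul_one]
    · rintro (rfl | rfl | rfl)
      · exact hmem δ hδ
      · exact hmem (-δ) (by rw [neg_sq, hδ])
      · rw [mem_commonPoints_mk_iff, hQ, hQ']
        constructor <;> ring
  · refine ⟨_, dualVec i α 1 (1 / 2) (-1 / 2) 0, dualVec i α 1 0 0 1, mem_submodule_mk hT,
      linearIndependent_dualVec i hα one_ne_zero (by norm_num),
      isGermOfTypeA_three hβ hβ' hne (mul_ne_zero hs hs') fun w => ?_⟩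
    rw [dualVec_add_smul, map_mul, hQ, hQ']
    ring

theorem sq_add_self_add_one_eq_zero {t : ℂ} (h : t ^ 3 = 1) (h1 : t ≠ 1) : t ^ 2 + t + 1 = 0 := by
  have : (t - 1) * (t ^ 2 + t + 1) = 0 := by linear_combination h
  exact (mul_eq_zero.1 this).resolve_left (sub_ne_zero.2 h1)

theorem commonPoints_same_index (i : Fin 3) {α β α' β' : ℂ} (hα : α ^ 3 = 1)
    (hβ : 2 * β ^ 3 = -1) (hα' : α' ^ 3 = 1) (hβ' : 2 * β' ^ 3 = -1) (hne : α ≠ α') :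
    (commonPoints (contactConic i α β) (contactConic i α' β')).ncard = 4 ∧
      ∀ p ∈ commonPoints (contactConic i α β) (contactConic i α' β'),
        IsNode (contactConic i α β) (contactConic i α' β') p := by
  have hα0 : α ≠ 0 := by rintro rfl; norm_num at hα
  have hβ0 := root_ne_zero hβ
  -- In coordinates adapted to the first conic, the second depends only on the ratios `ρ` and `σ`.
  -- Since `ρ` is a primitive cube root of unity, `σ` is `1`, `ρ` or `ρ²`.
  obtain ⟨ρ, hρ⟩ : ∃ ρ, ρ = α' / α := ⟨_, rfl⟩
  obtain ⟨σ, hσ⟩ : ∃ σ, σ = β' / β := ⟨_, rfl⟩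
  have hρ3 : ρ ^ 3 = 1 := by rw [hρ, div_pow, hα, hα', div_one]
  have hρ1 : ρ ≠ 1 := by
    rintro rfl
    rw [eq_comm, div_eq_one_iff_eq hα0] at hρ
    exact hne hρ.symm
  have hσ3 : σ ^ 3 = 1 := by
    rw [hσ, div_pow, div_eq_one_iff_eq (pow_ne_zero 3 hβ0)]
    linear_combination hβ' / 2 - hβ / 2
  have hρ2 := sq_add_self_add_one_eq_zero hρ3 hρ1
  obtain ⟨s, hs, hf⟩ := contactConic_form i α' β'
  refine commonPoints_of_isTransversal (a := 1) (b := ρ ^ 2) (c := -4 * σ ^ 2) (d := -2 * ρ)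
    (e := 2 * σ) (f := 2 * (ρ * σ)) hα0 hβ0 hs (fun x y z => ?_) ?_ ?_
  · have e1 : α' * dualVec i α β x y z (i + 1) = ρ * y := by
      rw [dualVec_add_one, hρ]
      field_simp
    have e2 : β' * dualVec i α β x y z (i + 2) = σ * z := by
      rw [dualVec_add_two, hσ]
      field_simp
    rw [hf, map_mul, eval_C, eval_contactForm, dualVec_self, e1, e2]
    ring
  · have : 1 + ρ ^ 2 + -2 * ρ = (ρ - 1) ^ 2 := by ring
    rw [this]
    exact pow_ne_zero 2 (sub_ne_zero.2 hρ1)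
  · have : (σ - 1) * ((σ - ρ) * (σ - ρ ^ 2)) = 0 := by
      linear_combination hσ3 - (σ ^ 2 - σ * ρ) * hρ2 - hρ3
    rcases mul_eq_zero.1 this with h | h
    · obtain rfl := sub_eq_zero.1 h
      convert isTransversal_same_one hρ2 using 1 <;> ring
    rcases mul_eq_zero.1 h with h | h
    · obtain rfl := sub_eq_zero.1 h
      convert isTransversal_same_self hρ2 using 1; ring
    · obtain rfl := sub_eq_zero.1 h
      convert isTransversal_same_sq hρ2 using 1 <;> ring

theorem commonPoints_next_index (i : Fin 3) {α β α' β' : ℂ} (hα : α ^ 3 = 1)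
    (hβ : 2 * β ^ 3 = -1) (hα' : α' ^ 3 = 1) (hβ' : 2 * β' ^ 3 = -1) :
    (commonPoints (contactConic i α β) (contactConic (i + 1) α' β')).ncard = 4 ∧
      ∀ p ∈ commonPoints (contactConic i α β) (contactConic (i + 1) α' β'),
        IsNode (contactConic i α β) (contactConic (i + 1) α' β') p := by
  have hα0 : α ≠ 0 := by rintro rfl; norm_num at hα
  have hβ0 := root_ne_zero hβ
  have hβ3 : β ^ 3 = -1 / 2 := by linear_combination hβ / 2
  have hβ3' : β' ^ 3 = -1 / 2 := by linear_combination hβ' / 2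
  -- In the coordinates of the first conic, `α²` times the second form is `(y - μz)² + m x (y + μz)
  -- - m² x²`. Since `m³ = -4` and `μ³ = -2`, `θ = μm / 2` is a cube root of unity, and `μ` is
  -- eliminated in favour of `θ` and `m`.
  obtain ⟨m, hm⟩ : ∃ m, m = 2 * (α * β') := ⟨_, rfl⟩
  obtain ⟨μ, hμ⟩ : ∃ μ, μ = α * α' / β := ⟨_, rfl⟩
  have hm3 : m ^ 3 = -4 := by
    rw [hm, mul_pow, mul_pow, hα, hβ3']
    norm_num
  have hμ3 : μ ^ 3 = -2 := by
    rw [hμ, div_pow, mul_pow, hα, hα', hβ3]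
    norm_num
  obtain ⟨θ, hθ⟩ : ∃ θ, θ = μ * m / 2 := ⟨_, rfl⟩
  have hθ3 : θ ^ 3 = 1 := by
    rw [hθ, div_pow, mul_pow, hm3, hμ3]
    norm_num
  obtain ⟨s, hs, hf⟩ := contactConic_form (i + 1) α' β'
  refine commonPoints_of_isTransversal (a := -m ^ 2) (b := 1) (c := -θ ^ 2 * m) (d := m)
    (e := 2 * θ) (f := θ * m ^ 2) (t := s / α ^ 2) hα0 hβ0 (div_ne_zero hs (pow_ne_zero 2 hα0))
    (fun x y z => ?_) ?_ ?_
  · have k1 : i + 1 + 1 = i + 2 := (by decide : ∀ i : Fin 3, i + 1 + 1 = i + 2) i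
    have k2 : i + 1 + 2 = i := (by decide : ∀ i : Fin 3, i + 1 + 2 = i) i
    have e1 : dualVec i α β x y z (i + 1) = y / α := dualVec_add_one _ _ _ _ _ _
    have e2 : α' * dualVec i α β x y z (i + 2) = μ * z / α := by
      rw [dualVec_add_two, hμ]
      field_simp
    have e3 : β' * x = m * x / (2 * α) := by
      rw [hm]
      field_simp
    have c1 : -θ ^ 2 * m = μ ^ 2 := by rw [hθ]; linear_combination -(μ ^ 2 / 4) * hm3
    have c2 : θ * m ^ 2 = -2 * μ := by rw [hθ]; linear_combination (μ / 2) * hm3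
    have c3 : 2 * θ = μ * m := by rw [hθ]; ring
    rw [hf, map_mul, eval_C, eval_contactForm, k1, k2, dualVec_self, e1, e2, e3, c1, c2, c3]
    field_simp
    ring
  · intro h
    refine sq_add_sub_ne_zero (x := 1) (y := m / 2) (one_pow 3) ?_ (by linear_combination h)
    linear_combination hm3 / 4
  · by_cases h1 : θ = 1
    · subst h1
      convert isTransversal_next_one (m := m) (by linear_combination hm3) using 1 <;> ring
    · exact isTransversal_next (sq_add_self_add_one_eq_zero hθ3 h1) (by linear_combination hm3)

theorem commonPoints_of_ne {i i' : Fin 3} {α β α' β' : ℂ} (hα : α ^ 3 = 1)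
    (hβ : 2 * β ^ 3 = -1) (hα' : α' ^ 3 = 1) (hβ' : 2 * β' ^ 3 = -1)
    (hne : ¬ (i = i' ∧ α = α')) :
    (commonPoints (contactConic i α β) (contactConic i' α' β')).ncard = 4 ∧
      ∀ p ∈ commonPoints (contactConic i α β) (contactConic i' α' β'),
        IsNode (contactConic i α β) (contactConic i' α' β') p := by
  -- Indices are cyclic modulo 3: distinct ones are consecutive in one order or the other, so
  -- swapping the conics suffices.
  have hi : i' = i ∨ i' = i + 1 ∨ i = i' + 1 :=
    (by decide : ∀ i i' : Fin 3, i' = i ∨ i' = i + 1 ∨ i = i' + 1) i i'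
  rcases hi with rfl | rfl | rfl
  · exact commonPoints_same_index _ hα hβ hα' hβ' fun h => hne ⟨rfl, h⟩
  · exact commonPoints_next_index _ hα hβ hα' hβ'
  · rw [commonPoints_comm]
    obtain ⟨h1, h2⟩ := commonPoints_next_index i' hα' hβ' hα hβ
    exact ⟨h1, fun p hp => (h2 p hp).symm⟩

end PlaneCurve

open PlaneCurve
theorem proposition4p5 (ω : ℂ) (hω : IsPrimitiveRoot ω 3) :
    fermatConics.ncard = 27 ∧
    (⋃ j, conicClass ω j) = fermatConics ∧
    (∀ i j, i ≠ j → Disjoint (conicClass ω i) (conicClass ω j)) ∧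
    (∀ j, (conicClass ω j).ncard = 3) ∧
    (∀ j, ∀ Q ∈ conicClass ω j, ∀ Q' ∈ conicClass ω j, Q ≠ Q' →
      ∃ n₁ n₂ t : Plane, n₁ ≠ n₂ ∧ n₁ ≠ t ∧ n₂ ≠ t ∧
        commonPoints Q Q' = {n₁, n₂, t} ∧
        IsNode Q Q' n₁ ∧ IsNode Q Q' n₂ ∧ IsTacnode Q Q' t) ∧
    (∀ i j, i ≠ j → ∀ Q ∈ conicClass ω i, ∀ Q' ∈ conicClass ω j,
      (commonPoints Q Q').ncard = 4 ∧ ∀ p ∈ commonPoints Q Q', IsNode Q Q' p) := by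

  refine ⟨ncard_fermatConics hω, iUnion_conicClass hω, fun i j hij => disjoint_conicClass hω hij,
    ncard_conicClass hω, fun j Q hQ Q' hQ' hne => ?_, fun i j hij Q hQ Q' hQ' => ?_⟩
  · rw [conicClass_eq hω] at hQ hQ'
    obtain ⟨β, hβ, rfl⟩ := hQ
    obtain ⟨β', hβ', rfl⟩ := hQ'
    exact commonPoints_same_class _ (pow_ne_zero _ (hω.ne_zero (by norm_num))) (root_ne_zero hβ)
      (root_ne_zero hβ') fun h => hne (by rw [h])
  · rw [conicClass_eq hω] at hQ hQ'
    obtain ⟨β, hβ, rfl⟩ := hQ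
    obtain ⟨β', hβ', rfl⟩ := hQ'
    have h3 : ∀ n : ℕ, (ω ^ n) ^ 3 = 1 := fun n => by
      rw [← pow_mul, mul_comm, pow_mul, hω.pow_eq_one, one_pow]
    refine commonPoints_of_ne (h3 _) hβ (h3 _) hβ' fun ⟨h1, h2⟩ => hij ?_
    refine eq_of_pointIndex_eq hω h1 ?_
    rw [h2, ← pow_add, show 2 * pointExponent j + pointExponent j = pointExponent j * 3 by ring,
      pow_mul, h3]
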